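/- For a module $M$ over a commutative ring $A$, let $\operatorname{tr}_A(M)=\sum_{f\in\operatorname{Hom}_A(M,A)}\operatorname{Im} f$ be its trace ideal. For a Cohen--Macaulay (noetherian) local ring $A$ with a canonical module $\omega_A$ (a maximal Cohen--Macaulay module of type one and of finite injective dimension), let $\operatorname{res}(A)=\ell_A(A/\operatorname{tr}_A(\omega_A))\in\mathbb{N}\cup\{\infty\}$. Let $R$ be a Cohen--Macaulay local ring with a canonical module $\omega_R$, let $\underline{x}=x_1,\dots,x_t$ ($t\ge 0$) be an $R$-regular sequence, and let $u\ge 1$ be an integer. For $n\ge 1$ write $(\underline{x}^{n})=(x_1^{n},\dots,x_t^{n})$. Let $R'=R/(\underline{x}^{u+1})$, with natural surjection $\pi\colon R\to R'$. Assume that $x_1,\dots,x_t$ all annihilate $\operatorname{Ext}^i_R(\omega_R,R)$ for every $i=1,\dots,t$. Then $R'$ is a Cohen--Macaulay local ring which has a canonical module, and for every canonical module $\omega_{R'}$ of $R'$: 1. $\operatorname{tr}_R(\omega_R)+(\underline{x}^{u})=\pi^{-1}\bigl(\operatorname{tr}_{R'}(\omega_{R'})\bigr)+(\underline{x}^{u})$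 as ideals of $R$. 2. If $(\underline{x}^{u})\subseteq\operatorname{tr}_R(\omega_R)$, then $\operatorname{res}(R)=\operatorname{res}(R')$. -/

import Mathlib

universe u

/-- The trace ideal of an `R`-module `M`: the sum of the images of all `R`-linear maps `M → R`. -/
def traceIdeal (R : Type u) [CommRing R] (M : Type u) [AddCommGroup M] [Module R M] : Ideal R :=
  ⨆ f : M →ₗ[R] R, LinearMap.range f

/-- A nonzero finitely generated module `M` over a (noetherian) local ring `R` is maximal
Cohen-Macaulay if `depth M = dim R`.  As `depth M ≤ dim M ≤ dim R` always holds, this says that the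
maximal ideal contains an `M`-regular sequence of length `dim R` (regularity includes `M ≠ 0`). -/
structure IsMaximalCohenMacaulay (R : Type u) [CommRing R] [IsLocalRing R]
    (M : Type u) [AddCommGroup M] [Module R M] : Prop where
  finite : Module.Finite R M
  exists_regular : ∃ rs : List R, (∀ r ∈ rs, r ∈ IsLocalRing.maximalIdeal R) ∧
    RingTheory.Sequence.IsRegular M rs ∧ (rs.length : WithBot ℕ∞) = ringKrullDim R

/-- A Cohen-Macaulay local ring: a noetherian local ring with `depth R = dim R`. -/
structure IsCohenMacaulayLocal (R : Type u) [CommRing R] [IsLocalRing R] : Prop where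
  noetherian : IsNoetherianRing R
  depth_eq_dim : IsMaximalCohenMacaulay R R

/-- A canonical module of a Cohen-Macaulay local ring `R` with residue field `k` and dimension `d`:
a maximal Cohen-Macaulay module `M` of finite injective dimension and of type one.  The type of a
maximal Cohen-Macaulay module is the `k`-dimension of `Ext^d(k, M)`, which is one exactly when this
`Ext` is isomorphic to `k`. -/
structure IsCanonicalModule (R : Type u) [CommRing R] [IsLocalRing R]
    (M : Type u) [AddCommGroup M] [Module R M] : Prop where
  maximalCohenMacaulay : IsMaximalCohenMacaulay R M
  finite_injectiveDimension :
    ∃ n : ℕ, CategoryTheory.HasInjectiveDimensionLE (ModuleCat.of R M) n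
  type_one : ∀ d : ℕ, ringKrullDim R = (d : WithBot ℕ∞) →
    Nonempty (CategoryTheory.Abelian.Ext
        (ModuleCat.of R (IsLocalRing.ResidueField R)) (ModuleCat.of R M) d
      ≃ₗ[R] IsLocalRing.ResidueField R)

/-- The residue of a Cohen-Macaulay local ring `R` with canonical module `ω`: the colength of the
trace ideal of `ω`, with value `⊤` if it is infinite. -/
noncomputable def canonicalResidue (R : Type u) [CommRing R]
    (ω : Type u) [AddCommGroup ω] [Module R ω] : ℕ∞ :=
  Module.length R (R ⧸ traceIdeal R ω)

/-- The ideal generated by the `n`-th powers `x₁ ^ n, …, xₜ ^ n` of a sequence `x₁, …, xₜ`. -/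
def powersIdeal {R : Type u} [CommRing R] (x : List R) (n : ℕ) : Ideal R :=
  Ideal.ofList (x.map fun a => a ^ n)

/-! Every `f : ω → R` reduces to a map `ω/(x^{u+1})ω → R'`, so `tr_R(ω)` always lies in the preimage
of the trace of `ω/(x^{u+1})ω`. The content is the opposite inclusion up to `(x^u)`: a map `g : ω →
R/(x^{u+1})` need not lift to `R`, but its reduction modulo `(x^u)` does.

For one element `x`, the obstruction to lifting `g` is its boundary in `Ext¹(ω, R)`. Passing from
`R/x^{u+1}` to `R/x^u` multiplies the boundary by `x` (`δsmul_map_projPow`), and `x` kills `Ext¹(ω,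
R)`. A longer sequence is handled one element at a time, replacing `R` by `R/x₁^{u+1}`. This needs
the annihilation hypothesis to survive on `Ext^i(ω, R/x₁^{u+1})`, with the elements themselves and
not merely their squares. That is `smul_ext_quotSMulTop_pow_eq_zero`, the place where `u ≥ 1` is
essential. The outcome is `exists_lift_of_smul_ext_eq_zero`.

Two standard facts about canonical modules finish the proof. First, `ω/(x^{u+1})ω` is canonical over
`R'` (`IsCanonicalModule.quotient_ofList`). Second, any two canonical modules have the same trace
(`IsCanonicalModule.traceIdeal_le`), because each surjects onto the other. Both rest on Rees'
theorem and on reading type one as simplicity of the socle modulo a maximal regular sequence. -/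

open CategoryTheory Abelian Pointwise RingTheory.Sequence

/-! ### Ext of modules: functoriality and long exact sequences. -/

section ModuleExt

variable (R : Type u) [CommRing R]

/-- The `Ext`-module of two unbundled modules. -/
abbrev ModuleExt (N M : Type u) [AddCommGroup N] [AddCommGroup M] [Module R N] [Module R M]
    (n : ℕ) : Type u :=
  Ext (ModuleCat.of R N) (ModuleCat.of R M) n

namespace ModuleExt

variable {R}
variable {N N' N'' M M' M'' : Type u} [AddCommGroup N] [AddCommGroup N'] [AddCommGroup N'']
  [AddCommGroup M] [AddCommGroup M'] [AddCommGroup M''] [Module R N] [Module R N'] [Module R N'']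
  [Module R M] [Module R M'] [Module R M'']

/-- Functoriality of `Ext` in the second variable. -/
noncomputable def map (N : Type u) [AddCommGroup N] [Module R N] (f : M →ₗ[R] M') (n : ℕ) :
    ModuleExt R N M n →ₗ[R] ModuleExt R N M' n :=
  (Ext.mk₀ (ModuleCat.ofHom f)).postcompOfLinear R (ModuleCat.of R N) (add_zero n)

/-- Functoriality of `Ext` in the first variable. -/
noncomputable def comap (f : N →ₗ[R] N') (M : Type u) [AddCommGroup M] [Module R M] (n : ℕ) :
    ModuleExt R N' M n →ₗ[R] ModuleExt R N M n :=
  (Ext.mk₀ (ModuleCat.ofHom f)).precompOfLinear R (ModuleCat.of R M) (zero_add n)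

/-- `Ext⁰` is `Hom`. -/
noncomputable def homEquiv : ModuleExt R N M 0 ≃ₗ[R] (N →ₗ[R] M) :=
  Ext.linearEquiv₀.trans ModuleCat.homLinearEquiv

theorem homEquiv_symm_apply (g : N →ₗ[R] M) : homEquiv.symm g = Ext.mk₀ (ModuleCat.ofHom g) := rfl

theorem homEquiv_map (f : M →ₗ[R] M') (e : ModuleExt R N M 0) :
    homEquiv (map N f 0 e) = f ∘ₗ homEquiv e := by
  obtain ⟨g, rfl⟩ := homEquiv.symm.surjective e
  rw [← LinearEquiv.eq_symm_apply, LinearEquiv.apply_symm_apply, homEquiv_symm_apply,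
    homEquiv_symm_apply, ModuleCat.ofHom_comp]
  exact Ext.mk₀_comp_mk₀ _ _

theorem homEquiv_comap (f : N →ₗ[R] N') (e : ModuleExt R N' M 0) :
    homEquiv (comap f M 0 e) = homEquiv e ∘ₗ f := by
  obtain ⟨g, rfl⟩ := homEquiv.symm.surjective e
  rw [← LinearEquiv.eq_symm_apply, LinearEquiv.apply_symm_apply, homEquiv_symm_apply,
    homEquiv_symm_apply, ModuleCat.ofHom_comp]
  exact Ext.mk₀_comp_mk₀ _ _

theorem map_comp_apply (f : M →ₗ[R] M') (g : M' →ₗ[R] M'') (n : ℕ) (e : ModuleExt R N M n) :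
    map N (g ∘ₗ f) n e = map N g n (map N f n e) := by
  refine Eq.trans ?_ (Ext.comp_assoc_of_third_deg_zero _ _ _ (add_zero n)).symm
  rw [Ext.mk₀_comp_mk₀]
  rfl

theorem map_smul_id (r : R) (n : ℕ) (e : ModuleExt R N M n) :
    map N (r • LinearMap.id) n e = r • e :=
  (Ext.smul_eq_comp_mk₀ e r).symm

theorem map_id (n : ℕ) (e : ModuleExt R N M n) : map N LinearMap.id n e = e := by
  simpa using map_smul_id (1 : R) n e

theorem comap_comp_apply (f : N →ₗ[R] N') (g : N' →ₗ[R] N'') (n : ℕ) (e : ModuleExt R N'' M n) :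
    comap (g ∘ₗ f) M n e = comap f M n (comap g M n e) :=
  (Ext.mk₀_comp_mk₀_assoc (ModuleCat.ofHom f) (ModuleCat.ofHom g) e).symm

theorem comap_smul_id (r : R) (n : ℕ) (e : ModuleExt R N M n) :
    comap (r • LinearMap.id) M n e = r • e := by
  change (Ext.mk₀ (r • 𝟙 (ModuleCat.of R N))).comp e (zero_add n) = r • e
  rw [Ext.mk₀_smul, Ext.smul_comp, Ext.mk₀_id_comp]

theorem comap_id (n : ℕ) (e : ModuleExt R N M n) : comap LinearMap.id M n e = e := by
  simpa using comap_smul_id (1 : R) n e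

theorem map_zero_apply (n : ℕ) (e : ModuleExt R N M n) : map N (0 : M →ₗ[R] M') n e = 0 := by
  change Ext.comp e (Ext.mk₀ 0) (add_zero n) = 0
  rw [Ext.mk₀_zero, Ext.comp_zero]

theorem comap_zero_apply (n : ℕ) (e : ModuleExt R N' M n) :
    comap (0 : N →ₗ[R] N') M n e = 0 := by
  change (Ext.mk₀ 0).comp e (zero_add n) = 0
  rw [Ext.mk₀_zero, Ext.zero_comp]

/-- `Ext` as a functor of linear equivalences in the second variable. -/
noncomputable def congrRight (N : Type u) [AddCommGroup N] [Module R N] (f : M ≃ₗ[R] M') (n : ℕ) :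
    ModuleExt R N M n ≃ₗ[R] ModuleExt R N M' n :=
  LinearEquiv.ofLinearMap (map N f.toLinearMap n) (map N f.symm.toLinearMap n)
    (by ext e; rw [LinearMap.comp_apply, ← map_comp_apply]; simp [map_id])
    (by ext e; rw [LinearMap.comp_apply, ← map_comp_apply]; simp [map_id])

/-- `Ext` as a functor of linear equivalences in the first variable. -/
noncomputable def congrLeft (f : N ≃ₗ[R] N') (M : Type u) [AddCommGroup M] [Module R M] (n : ℕ) :
    ModuleExt R N' M n ≃ₗ[R] ModuleExt R N M n :=
  LinearEquiv.ofLinearMap (comap f.toLinearMap M n) (comap f.symm.toLinearMap M n)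
    (by ext e; rw [LinearMap.comp_apply, ← comap_comp_apply]; simp [comap_id])
    (by ext e; rw [LinearMap.comp_apply, ← comap_comp_apply]; simp [comap_id])

section ShortExact

variable {A B C : Type u} [AddCommGroup A] [AddCommGroup B] [AddCommGroup C]
  [Module R A] [Module R B] [Module R C] {f : A →ₗ[R] B} {g : B →ₗ[R] C}
  (hf : Function.Injective f) (hfg : Function.Exact f g) (hg : Function.Surjective g)

include hf hfg hg in
theorem shortExact :
    (ModuleCat.shortComplexOfCompEqZero f g hfg.linearMap_comp_eq_zero).ShortExact :=
  ModuleCat.shortComplex_shortExact _ hfg hf hg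

/-- The class of an extension. -/
noncomputable def extClass : ModuleExt R C A 1 := (shortExact hf hfg hg).extClass

/-- The connecting map of the covariant long exact sequence. -/
noncomputable def δ (N : Type u) [AddCommGroup N] [Module R N] (n : ℕ) :
    ModuleExt R N C n →ₗ[R] ModuleExt R N A (n + 1) :=
  (extClass hf hfg hg).postcompOfLinear R (ModuleCat.of R N) rfl

/-- The connecting map of the contravariant long exact sequence. -/
noncomputable def coδ (M : Type u) [AddCommGroup M] [Module R M] (n : ℕ) :
    ModuleExt R A M n →ₗ[R] ModuleExt R C M (n + 1) :=
  (extClass hf hfg hg).precompOfLinear R (ModuleCat.of R M) (add_comm 1 n)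

theorem exact_δ_map (n : ℕ) : Function.Exact (δ hf hfg hg N n) (map N f (n + 1)) := by
  intro e
  refine ⟨fun h => Ext.covariant_sequence_exact₁ _ (shortExact hf hfg hg) e h rfl, ?_⟩
  rintro ⟨c, rfl⟩
  exact (Ext.comp_assoc_of_third_deg_zero _ _ _ _).trans
    ((congrArg (fun z => Ext.comp c z rfl) (shortExact hf hfg hg).extClass_comp).trans
      (Ext.comp_zero _ _ _ _ _))

include hf hfg hg in
theorem exact_map_map (n : ℕ) : Function.Exact (map N f n) (map N g n) := by
  intro e
  refine ⟨fun h => Ext.covariant_sequence_exact₂ _ (shortExact hf hfg hg) e h, ?_⟩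
  rintro ⟨c, rfl⟩
  rw [← map_comp_apply, hfg.linearMap_comp_eq_zero]
  exact map_zero_apply n c

theorem exact_map_δ (n : ℕ) : Function.Exact (map N g n) (δ hf hfg hg N n) := by
  intro e
  refine ⟨fun h => Ext.covariant_sequence_exact₃ _ (shortExact hf hfg hg) e rfl h, ?_⟩
  rintro ⟨c, rfl⟩
  exact (Ext.comp_assoc_of_second_deg_zero _ _ _ _).trans
    ((congrArg (fun z => Ext.comp c z rfl) (shortExact hf hfg hg).comp_extClass).trans
      (Ext.comp_zero _ _ _ _ _))

theorem exact_comap_coδ (n : ℕ) : Function.Exact (comap f M n) (coδ hf hfg hg M n) := by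
  intro e
  refine ⟨fun h => Ext.contravariant_sequence_exact₁ (shortExact hf hfg hg) _ e (add_comm 1 n) h, ?_⟩
  rintro ⟨c, rfl⟩
  exact (shortExact hf hfg hg).extClass_comp_assoc c (h := add_comm 1 n)

include hf hfg hg in
theorem exact_comap_comap (n : ℕ) : Function.Exact (comap g M n) (comap f M n) := by
  intro e
  refine ⟨fun h => Ext.contravariant_sequence_exact₂ (shortExact hf hfg hg) _ e h, ?_⟩
  rintro ⟨c, rfl⟩
  rw [← comap_comp_apply, hfg.linearMap_comp_eq_zero]
  exact comap_zero_apply n c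

theorem exact_coδ_comap (n : ℕ) : Function.Exact (coδ hf hfg hg M n) (comap g M (n + 1)) := by
  intro e
  refine ⟨fun h => Ext.contravariant_sequence_exact₃ (shortExact hf hfg hg) _ e h (add_comm 1 n), ?_⟩
  rintro ⟨c, rfl⟩
  exact (shortExact hf hfg hg).comp_extClass_assoc c (add_comm 1 n)

theorem comap_δ (h : N →ₗ[R] N') (n : ℕ) (e : ModuleExt R N' C n) :
    comap h A (n + 1) (δ hf hfg hg N' n e) = δ hf hfg hg N n (comap h C n e) :=
  (Ext.comp_assoc _ _ _ (zero_add n) rfl (by omega)).symm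

variable {A' B' C' : Type u} [AddCommGroup A'] [AddCommGroup B'] [AddCommGroup C']
  [Module R A'] [Module R B'] [Module R C'] {f' : A' →ₗ[R] B'} {g' : B' →ₗ[R] C'}
  (hf' : Function.Injective f') (hfg' : Function.Exact f' g') (hg' : Function.Surjective g')

/-- Extension classes are natural in morphisms of short exact sequences. Taking `a` to be a
multiplication is what makes a scalar factor appear in a boundary. -/
theorem map_δ {a : A →ₗ[R] A'} {b : B →ₗ[R] B'} {c : C →ₗ[R] C'} (hab : f' ∘ₗ a = b ∘ₗ f)
    (hbc : g' ∘ₗ b = c ∘ₗ g) (n : ℕ) (e : ModuleExt R N C n) :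
    map N a (n + 1) (δ hf hfg hg N n e) = δ hf' hfg' hg' N n (map N c n e) := by
  have hnat := ShortComplex.ShortExact.extClass_naturality (shortExact hf hfg hg)
    (shortExact hf' hfg' hg')
    { τ₁ := ModuleCat.ofHom a
      τ₂ := ModuleCat.ofHom b
      τ₃ := ModuleCat.ofHom c
      comm₁₂ := ModuleCat.hom_ext hab
      comm₂₃ := ModuleCat.hom_ext hbc }
  exact (Ext.comp_assoc_of_third_deg_zero _ _ _ _).trans
    ((congrArg (fun z => Ext.comp e z rfl) hnat).trans
      (Ext.comp_assoc_of_second_deg_zero _ _ _ _).symm)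

end ShortExact

theorem smul_id_injective {r : R} (hr : IsSMulRegular M r) :
    Function.Injective (r • LinearMap.id : M →ₗ[R] M) := hr

/-- The short exact sequence `M → M → M ⧸ r M` of an `M`-regular element `r`. -/
noncomputable def δsmul {r : R} (hr : IsSMulRegular M r) (N : Type u) [AddCommGroup N] [Module R N]
    (n : ℕ) : ModuleExt R N (QuotSMulTop r M) n →ₗ[R] ModuleExt R N M (n + 1) :=
  δ (f := r • LinearMap.id) (smul_id_injective hr)
    (LinearMap.exact_lsmul_mkQ_smul_top M r) (Submodule.mkQ_surjective _) N n

theorem exact_δsmul_smul {r : R} (hr : IsSMulRegular M r) (n : ℕ) :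
    Function.Exact (δsmul hr N n) (fun e : ModuleExt R N M (n + 1) => r • e) := by
  have := exact_δ_map (f := r • LinearMap.id) (N := N) (smul_id_injective hr)
    (LinearMap.exact_lsmul_mkQ_smul_top M r)
    (Submodule.mkQ_surjective _) n
  intro e
  change r • e = 0 ↔ _
  rw [← map_smul_id r]
  exact this e

theorem exact_map_δsmul {r : R} (hr : IsSMulRegular M r) (n : ℕ) :
    Function.Exact (map N (r • (⊤ : Submodule R M)).mkQ n) (δsmul hr N n) :=
  exact_map_δ (f := r • LinearMap.id) (smul_id_injective hr) (LinearMap.exact_lsmul_mkQ_smul_top M r)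
    (Submodule.mkQ_surjective _) n

theorem comap_δsmul {r : R} (hr : IsSMulRegular M r) (h : N →ₗ[R] N') (n : ℕ)
    (e : ModuleExt R N' (QuotSMulTop r M) n) :
    comap h M (n + 1) (δsmul hr N' n e) = δsmul hr N n (comap h _ n e) :=
  comap_δ (f := r • LinearMap.id) (smul_id_injective hr) (LinearMap.exact_lsmul_mkQ_smul_top M r)
    (Submodule.mkQ_surjective _) h n e

theorem map_δsmul {r r' : R} (hr : IsSMulRegular M r) (hr' : IsSMulRegular M' r')
    {a b : M →ₗ[R] M'} {c : QuotSMulTop r M →ₗ[R] QuotSMulTop r' M'}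
    (hab : (r' • LinearMap.id) ∘ₗ a = b ∘ₗ (r • LinearMap.id))
    (hbc : (r' • (⊤ : Submodule R M')).mkQ ∘ₗ b = c ∘ₗ (r • (⊤ : Submodule R M)).mkQ) (n : ℕ)
    (e : ModuleExt R N (QuotSMulTop r M) n) :
    map N a (n + 1) (δsmul hr N n e) = δsmul hr' N n (map N c n e) :=
  map_δ (f := r • LinearMap.id) (f' := r' • LinearMap.id) (smul_id_injective hr)
    (LinearMap.exact_lsmul_mkQ_smul_top M r) (Submodule.mkQ_surjective _) (smul_id_injective hr')
    (LinearMap.exact_lsmul_mkQ_smul_top M' r') (Submodule.mkQ_surjective _) hab hbc n e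

theorem smul_eq_zero_of_mem_annihilator {r : R} (hr : r ∈ Module.annihilator R N) {n : ℕ}
    (e : ModuleExt R N M n) : r • e = 0 := by
  have : (r • LinearMap.id : N →ₗ[R] N) = (0 : R) • LinearMap.id := by
    ext x
    simpa using Module.mem_annihilator.1 hr x
  rw [← comap_smul_id, this, comap_smul_id, zero_smul]

end ModuleExt
end ModuleExt

/-! ### Weakly regular sequences, extensions and powers. -/

section Regular
variable {R : Type*} [CommRing R]

/-- Regularity of `r` on `C` keeps `A/rA → B/rB` injective, so the short exact sequence survives
modulo `r` and the induction goes on. -/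
theorem isWeaklyRegular_of_exact {A B C : Type*} [AddCommGroup A] [AddCommGroup B] [AddCommGroup C]
    [Module R A] [Module R B] [Module R C] {f : A →ₗ[R] B} {g : B →ₗ[R] C} {rs : List R}
    (hf : Function.Injective f) (hfg : Function.Exact f g) (hg : Function.Surjective g)
    (hA : IsWeaklyRegular A rs) (hC : IsWeaklyRegular C rs) : IsWeaklyRegular B rs := by
  induction rs generalizing A B C with
  | nil => exact IsWeaklyRegular.nil R B
  | cons r rs ih =>
    rw [isWeaklyRegular_cons_iff] at hA hC ⊢
    have hr : IsSMulRegular B r := by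
      rw [isSMulRegular_iff_right_eq_zero_of_smul]
      intro b hb
      have hgb : g b = 0 := hC.1.right_eq_zero_of_smul (by rw [← map_smul, hb, map_zero])
      obtain ⟨a, rfl⟩ := (hfg b).1 hgb
      rw [← map_smul] at hb
      rw [hA.1.right_eq_zero_of_smul (hf (hb.trans (map_zero f).symm)), map_zero]
    refine ⟨hr, ih (f := QuotSMulTop.map r f) (g := QuotSMulTop.map r g) ?_
      (QuotSMulTop.map_exact r hfg hg) (QuotSMulTop.map_surjective r hg) hA.2 hC.2⟩
    rw [← LinearMap.ker_eq_bot, LinearMap.ker_eq_bot']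
    intro a ha
    induction a using Submodule.Quotient.induction_on with
    | H a =>
      obtain ⟨b, -, hb⟩ := (Submodule.mem_smul_pointwise_iff_exists _ _ _).1
        ((Submodule.Quotient.mk_eq_zero _).1 ha)
      have hgb : g b = 0 := hC.1.right_eq_zero_of_smul (by
        rw [← map_smul, hb]; exact hfg.apply_apply_eq_zero a)
      obtain ⟨a', rfl⟩ := (hfg b).1 hgb
      rw [← map_smul] at hb
      rw [Submodule.Quotient.mk_eq_zero, ← hf (show f (r • a') = f a from hb)]
      exact Submodule.smul_mem_pointwise_smul _ _ _ trivial

theorem isWeaklyRegular_of_subsingleton {M : Type*} [AddCommGroup M] [Module R M] [Subsingleton M]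
    (rs : List R) : IsWeaklyRegular M rs := by
  induction rs generalizing M with
  | nil => exact IsWeaklyRegular.nil R M
  | cons r rs ih =>
    exact (isWeaklyRegular_cons_iff _ _ _).2 ⟨fun _ _ _ => Subsingleton.elim _ _, ih⟩

variable {M : Type*} [AddCommGroup M] [Module R M]

/-- The map `M ⧸ x M → M ⧸ x ^ (k + 1) M` induced by multiplication by `x ^ k`. -/
def QuotSMulTop.mulPow (x : R) (k : ℕ) : QuotSMulTop x M →ₗ[R] QuotSMulTop (x ^ (k + 1)) M :=
  Submodule.mapQ _ _ (LinearMap.lsmul R M (x ^ k)) (by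
    intro m hm
    obtain ⟨n, -, rfl⟩ := (Submodule.mem_smul_pointwise_iff_exists _ _ _).1 hm
    refine (Submodule.mem_smul_pointwise_iff_exists _ _ _).2 ⟨n, trivial, ?_⟩
    rw [pow_succ, mul_smul, LinearMap.lsmul_apply])

/-- The projection `M ⧸ x ^ (k + 1) M → M ⧸ x ^ k M`. -/
def QuotSMulTop.projPow (x : R) (k : ℕ) :
    QuotSMulTop (x ^ (k + 1)) M →ₗ[R] QuotSMulTop (x ^ k) M :=
  Submodule.mapQ _ _ LinearMap.id (by
    intro m hm
    obtain ⟨n, -, rfl⟩ := (Submodule.mem_smul_pointwise_iff_exists _ _ _).1 hm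
    refine (Submodule.mem_smul_pointwise_iff_exists _ _ _).2 ⟨x • n, trivial, ?_⟩
    simp [pow_succ, mul_smul])

theorem QuotSMulTop.projPow_surjective (x : R) (k : ℕ) :
    Function.Surjective (QuotSMulTop.projPow (M := M) x k) := by
  intro m
  induction m using Submodule.Quotient.induction_on with
  | H m => exact ⟨Submodule.Quotient.mk m, rfl⟩

theorem QuotSMulTop.mulPow_injective {x : R} (hx : IsSMulRegular M x) (k : ℕ) :
    Function.Injective (QuotSMulTop.mulPow (M := M) x k) := by
  rw [← LinearMap.ker_eq_bot, LinearMap.ker_eq_bot']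
  intro m hm
  induction m using Submodule.Quotient.induction_on with
  | H m =>
    rw [QuotSMulTop.mulPow, Submodule.mapQ_apply, Submodule.Quotient.mk_eq_zero,
      Submodule.mem_smul_pointwise_iff_exists] at hm
    obtain ⟨n, -, hn⟩ := hm
    rw [pow_succ, mul_smul, LinearMap.lsmul_apply] at hn
    rw [Submodule.Quotient.mk_eq_zero, ← hx.pow k hn]
    exact Submodule.smul_mem_pointwise_smul _ _ _ trivial

theorem QuotSMulTop.exact_mulPow_projPow (x : R) (k : ℕ) :
    Function.Exact (QuotSMulTop.mulPow (M := M) x k) (QuotSMulTop.projPow (M := M) x k) := by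
  intro m
  induction m using Submodule.Quotient.induction_on with
  | H m =>
    constructor
    · intro hm
      rw [QuotSMulTop.projPow, Submodule.mapQ_apply, Submodule.Quotient.mk_eq_zero,
        Submodule.mem_smul_pointwise_iff_exists] at hm
      obtain ⟨n, -, hn⟩ := hm
      exact ⟨Submodule.Quotient.mk n, by rw [← show _ = m from hn]; rfl⟩
    · rintro ⟨n, hn⟩
      rw [← hn]
      induction n using Submodule.Quotient.induction_on with
      | H n =>
        refine (Submodule.Quotient.mk_eq_zero _).2 ?_
        exact Submodule.smul_mem_pointwise_smul n (x ^ k) ⊤ trivial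

/-- `M/x^{k+1}M` is an extension of `M/x^kM` by `M/xM`. The induction can start at `k = 0`, since
every sequence is weakly regular on the zero module. -/
theorem isWeaklyRegular_quotSMulTop_pow {x : R} {rs : List R} (h : IsWeaklyRegular M (x :: rs))
    (k : ℕ) : IsWeaklyRegular (QuotSMulTop (x ^ k) M) rs := by
  rw [isWeaklyRegular_cons_iff] at h
  induction k with
  | zero =>
    have : Subsingleton (QuotSMulTop (x ^ 0) M) := by
      rw [pow_zero, Submodule.Quotient.subsingleton_iff, one_smul]
    exact isWeaklyRegular_of_subsingleton rs
  | succ k ih =>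
    exact isWeaklyRegular_of_exact (QuotSMulTop.mulPow_injective h.1 k)
      (QuotSMulTop.exact_mulPow_projPow x k) (QuotSMulTop.projPow_surjective x k) h.2 ih

theorem isWeaklyRegular_map_pow {rs : List R} (h : IsWeaklyRegular M rs) (k : ℕ) :
    IsWeaklyRegular M (rs.map (· ^ k)) := by
  induction rs generalizing M with
  | nil => exact IsWeaklyRegular.nil R M
  | cons x rs ih =>
    rw [List.map_cons, isWeaklyRegular_cons_iff]
    exact ⟨((isWeaklyRegular_cons_iff _ _ _).1 h).1.pow k,
      ih (isWeaklyRegular_quotSMulTop_pow h k)⟩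

end Regular

/-! ### Lifting homomorphisms modulo powers. -/

section ExtLift

variable {R : Type u} [CommRing R]
variable {N M : Type u} [AddCommGroup N] [AddCommGroup M] [Module R N] [Module R M]

/-- The projection is the right end of a morphism between the sequences defined by `x^{k+1}` and
`x^k`, with the identity in the middle and multiplication by `x` on the left. -/
theorem δsmul_map_projPow {x : R} (hx : IsSMulRegular M x) (k i : ℕ)
    (c : ModuleExt R N (QuotSMulTop (x ^ (k + 1)) M) i) :
    ModuleExt.δsmul (hx.pow k) N i (ModuleExt.map N (QuotSMulTop.projPow x k) i c) =
      x • ModuleExt.δsmul (hx.pow (k + 1)) N i c := by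
  rw [← ModuleExt.map_smul_id]
  refine (ModuleExt.map_δsmul (hx.pow (k + 1)) (hx.pow k) (b := LinearMap.id) ?_ rfl i c).symm
  rw [pow_succ, mul_smul, LinearMap.smul_comp, LinearMap.comp_smul, LinearMap.id_comp,
    LinearMap.id_comp, smul_comm]

/-- The long exact sequence alone shows only that products of two annihilating elements kill `c`.
Here `c` is instead split as a class coming from `M` plus a class `x^k c₁` with `c₁` in `Ext^i(N,
M/xM)`. The element `y` kills the first directly; it moves `c₁` into the image of `Ext^i(N, M)`,
where the factor `x^k` vanishes. -/
theorem smul_ext_quotSMulTop_pow_eq_zero {x y : R} (hx : IsSMulRegular M x) {i k : ℕ} (hk : 1 ≤ k)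
    (hx₀ : ∀ e : ModuleExt R N M i, x • e = 0) (hy₀ : ∀ e : ModuleExt R N M i, y • e = 0)
    (hx₁ : ∀ e : ModuleExt R N M (i + 1), x • e = 0)
    (hy₁ : ∀ e : ModuleExt R N M (i + 1), y • e = 0)
    (c : ModuleExt R N (QuotSMulTop (x ^ (k + 1)) M) i) : y • c = 0 := by
  -- The image of `c` in `Ext^i(N, M/x^kM)` has boundary `x • δ c = 0`, so it comes from `M`.
  obtain ⟨a, ha⟩ := (ModuleExt.exact_map_δsmul (hx.pow k) i _).1
    ((δsmul_map_projPow hx k i c).trans (hx₁ _))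
  have hker : ModuleExt.map N (QuotSMulTop.projPow x k) i
      (c - ModuleExt.map N (x ^ (k + 1) • (⊤ : Submodule R M)).mkQ i a) = 0 := by
    rw [map_sub, ← ha, ← ModuleExt.map_comp_apply, sub_eq_zero]
    rfl
  obtain ⟨c₁, hc₁⟩ := (ModuleExt.exact_map_map (QuotSMulTop.mulPow_injective hx k)
      (QuotSMulTop.exact_mulPow_projPow x k) (QuotSMulTop.projPow_surjective x k) i _).1 hker
  obtain ⟨z, hz⟩ := (ModuleExt.exact_map_δsmul hx i (y • c₁)).1 (by rw [map_smul]; exact hy₁ _)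
  have hzero : ModuleExt.map N (QuotSMulTop.mulPow x k) i (y • c₁) = 0 := by
    have hcomm : QuotSMulTop.mulPow x k ∘ₗ (x • (⊤ : Submodule R M)).mkQ =
        (x ^ (k + 1) • (⊤ : Submodule R M)).mkQ ∘ₗ (x ^ k • LinearMap.id) := rfl
    have hpow : x ^ k • z = 0 := by
      rw [← Nat.sub_add_cancel hk, pow_succ, mul_smul, hx₀, smul_zero]
    rw [← hz, ← ModuleExt.map_comp_apply, hcomm, ModuleExt.map_comp_apply, ModuleExt.map_smul_id,
      hpow, map_zero]
  rw [map_smul, hc₁, smul_sub, ← map_smul, hy₀, map_zero, sub_zero] at hzero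
  exact hzero

theorem exists_lift_quotSMulTop_pow {x : R} (hx : IsSMulRegular M x) (k : ℕ)
    (h : ∀ e : ModuleExt R N M 1, x • e = 0) (g : N →ₗ[R] QuotSMulTop (x ^ (k + 1)) M) :
    ∃ f : N →ₗ[R] M, ∀ w m, g w = Submodule.Quotient.mk m →
      f w - m ∈ x ^ k • (⊤ : Submodule R M) := by
  obtain ⟨a, ha⟩ := (ModuleExt.exact_map_δsmul (hx.pow k) 0 _).1
    ((δsmul_map_projPow hx k 0 (ModuleExt.homEquiv.symm g)).trans (h _))
  replace ha := congrArg ModuleExt.homEquiv ha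
  rw [ModuleExt.homEquiv_map, ModuleExt.homEquiv_map, LinearEquiv.apply_symm_apply] at ha
  refine ⟨ModuleExt.homEquiv a, fun w m hw => ?_⟩
  have hfw := LinearMap.congr_fun ha w
  rw [LinearMap.comp_apply, LinearMap.comp_apply, hw] at hfw
  exact (Submodule.Quotient.eq _).1 hfw

theorem exists_lift_of_smul_ext_eq_zero {u : ℕ} (hu : 1 ≤ u) {xs : List R}
    (hxs : IsWeaklyRegular M xs)
    (h : ∀ i, 1 ≤ i → i ≤ xs.length → ∀ a ∈ xs,
      ∀ e : ModuleExt R N M i, a • e = 0)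
    (g : N →ₗ[R] M ⧸ (Ideal.ofList (xs.map (· ^ (u + 1))) • ⊤ : Submodule R M)) :
    ∃ f : N →ₗ[R] M, ∀ w m, g w = Submodule.Quotient.mk m →
      f w - m ∈ (Ideal.ofList (xs.map (· ^ u)) • ⊤ : Submodule R M) := by
  induction xs generalizing M with
  | nil =>
    have hbot : (Ideal.ofList (([] : List R).map (· ^ (u + 1))) • ⊤ : Submodule R M) = ⊥ := by simp
    refine ⟨(Submodule.quotEquivOfEqBot _ hbot).toLinearMap ∘ₗ g, fun w m hw => ?_⟩
    rw [LinearMap.comp_apply, hw, LinearEquiv.coe_coe, Submodule.quotEquivOfEqBot_apply_mk, sub_self]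
    exact zero_mem _
  | cons x xs ih =>
    have hx := ((isWeaklyRegular_cons_iff _ _ _).1 hxs).1
    let e := Submodule.quotOfListConsSMulTopEquivQuotSMulTopInner M (x ^ (u + 1))
      (xs.map (· ^ (u + 1)))
    -- Over `M/x^{u+1}M` the annihilation in degree `i` uses degrees `i` and `i + 1` over `M`; the
    -- lost degree matches the element removed from the sequence.
    obtain ⟨g₁, hg₁⟩ := ih (isWeaklyRegular_quotSMulTop_pow hxs (u + 1))
      (fun i hi hi' a ha c => smul_ext_quotSMulTop_pow_eq_zero hx hu
        (h i hi (by simp; omega) x (by simp)) (h i hi (by simp; omega) a (by simp [ha]))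
        (h (i + 1) (by omega) (by simpa using hi') x (by simp))
        (h (i + 1) (by omega) (by simpa using hi') a (by simp [ha])) c)
      (e.toLinearMap ∘ₗ g)
    obtain ⟨f, hf⟩ := exists_lift_quotSMulTop_pow hx u
      (h 1 le_rfl (by simp) x (by simp)) g₁
    refine ⟨f, fun w m hw => ?_⟩
    obtain ⟨m', hm'⟩ := Submodule.Quotient.mk_surjective _ (g₁ w)
    have h₁ := hf w m' hm'.symm
    have h₂ := hg₁ w (Submodule.Quotient.mk m) (by
      rw [LinearMap.comp_apply, hw]; rfl)
    rw [← hm', ← Submodule.Quotient.mk_sub] at h₂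
    have h₃ : m' - m ∈ x ^ u • (⊤ : Submodule R M) ⊔
        (Ideal.ofList (xs.map (· ^ u)) • ⊤ : Submodule R M) := by
      have hmap : (Ideal.ofList (xs.map (· ^ u)) • ⊤ : Submodule R (QuotSMulTop (x ^ (u + 1)) M)) =
          (Ideal.ofList (xs.map (· ^ u)) • ⊤ : Submodule R M).map (Submodule.mkQ _) := by
        rw [Submodule.map_smul'', Submodule.map_top, Submodule.range_mkQ]
      rw [hmap] at h₂
      obtain ⟨n, hn, hn'⟩ := h₂
      have h₄ : m' - m - n ∈ x ^ (u + 1) • (⊤ : Submodule R M) :=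
        (Submodule.Quotient.eq _).1 hn'.symm
      obtain ⟨l, -, hl⟩ := (Submodule.mem_smul_pointwise_iff_exists _ _ _).1 h₄
      rw [← sub_add_cancel (m' - m) n, ← hl, pow_succ, mul_smul]
      exact Submodule.add_mem_sup (Submodule.smul_mem_pointwise_smul _ _ _ trivial) hn
    rw [List.map_cons, Ideal.ofList_cons_smul, ← sub_add_sub_cancel (f w) m' m]
    exact add_mem (Submodule.mem_sup_left h₁) h₃

end ExtLift

/-! ### Depth, associated primes and maximal Cohen–Macaulay modules. -/

section Depth

theorem subsingleton_of_exact {A B C : Type*} [Zero A] [Zero B] [Zero C] [Subsingleton A]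
    [Subsingleton C] {f : A → B} {g : B → C} (hf : f 0 = 0) (h : Function.Exact f g) :
    Subsingleton B := by
  refine subsingleton_of_forall_eq 0 fun b => ?_
  obtain ⟨a, rfl⟩ := (h b).1 (Subsingleton.elim _ _)
  rw [Subsingleton.elim a 0, hf]

variable {R : Type u} [CommRing R]
variable {N M : Type u} [AddCommGroup N] [AddCommGroup M] [Module R N] [Module R M]

theorem subsingleton_ext_quotSMulTop {r : R} (hr : IsSMulRegular M r) (i : ℕ)
    (h₀ : Subsingleton (ModuleExt R N M i)) (h₁ : Subsingleton (ModuleExt R N M (i + 1))) :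
    Subsingleton (ModuleExt R N (QuotSMulTop r M) i) :=
  subsingleton_of_exact (map_zero _) (ModuleExt.exact_map_δsmul hr i)

theorem subsingleton_ext_quotient_of_isWeaklyRegular {ys : List R} (h : IsWeaklyRegular M ys)
    {i : ℕ} (hE : ∀ j, i ≤ j → j ≤ i + ys.length → Subsingleton (ModuleExt R N M j)) :
    Subsingleton (ModuleExt R N (M ⧸ (Ideal.ofList ys • ⊤ : Submodule R M)) i) := by
  induction ys generalizing M with
  | nil =>
    have := hE i le_rfl (by simp)
    exact (ModuleExt.congrRight N (Submodule.quotEquivOfEqBot _ (by simp)) i).toEquiv.subsingleton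
  | cons r ys ih =>
    rw [isWeaklyRegular_cons_iff] at h
    have := ih h.2 fun j hj hj' => subsingleton_ext_quotSMulTop h.1 j
      (hE j hj (by simp; omega)) (hE (j + 1) (by omega) (by simp; omega))
    exact (ModuleExt.congrRight N
      (Submodule.quotOfListConsSMulTopEquivQuotSMulTopInner M r ys) i).toEquiv.subsingleton

variable [IsLocalRing R]

open IsLocalRing

theorem maximalIdeal_smul_top_lt [Module.Finite R M] [Nontrivial M] :
    maximalIdeal R • (⊤ : Submodule R M) < ⊤ :=
  (Submodule.top_ne_ideal_smul_of_le_jacobson_annihilator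
    (maximalIdeal_le_jacobson _)).symm.lt_top

theorem support_quotient_maximalIdeal :
    Module.support R (R ⧸ maximalIdeal R) = PrimeSpectrum.zeroLocus (maximalIdeal R) := by
  rw [Module.support_eq_zeroLocus, Ideal.annihilator_quotient]

theorem mem_maximalIdeal_of_isRegular {ys : List R} (h : IsRegular R ys) :
    ∀ y ∈ ys, y ∈ maximalIdeal R := by
  intro y hy
  refine IsLocalRing.le_maximalIdeal (J := Ideal.ofList ys) (fun h' => h.top_ne_smul ?_)
    (Ideal.subset_span hy)
  rw [h', Submodule.top_smul]

variable [IsNoetherianRing R]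

theorem subsingleton_ext_residueField_of_isRegular [Module.Finite R M] {zs : List R}
    (hzs : ∀ z ∈ zs, z ∈ maximalIdeal R) (h : IsRegular M zs) {i : ℕ} (hi : i < zs.length) :
    Subsingleton (ModuleExt R (R ⧸ maximalIdeal R) M i) :=
  have := h.nontrivial
  ModuleCat.subsingleton_ext_of_exists_isRegular (maximalIdeal R) (ModuleCat.of R (R ⧸ maximalIdeal R))
    support_quotient_maximalIdeal.subset (ModuleCat.of R M) maximalIdeal_smul_top_lt zs hzs h i hi

/-- A regular sequence can be extended to one with the length of any other regular sequence. -/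
theorem exists_isRegular_append [Module.Finite R M] {ys zs : List R}
    (hys : ∀ y ∈ ys, y ∈ maximalIdeal R) (hy : IsWeaklyRegular M ys)
    (hzs : ∀ z ∈ zs, z ∈ maximalIdeal R) (hz : IsRegular M zs) (hlen : ys.length ≤ zs.length) :
    ∃ ws : List R, (∀ w ∈ ws, w ∈ maximalIdeal R) ∧
      IsRegular (M ⧸ (Ideal.ofList ys • ⊤ : Submodule R M)) ws ∧ IsRegular M (ys ++ ws) ∧
      (ys ++ ws).length = zs.length := by
  have := hz.nontrivial
  have hy' := (IsLocalRing.isRegular_iff_isWeaklyRegular_of_subset_maximalIdeal hys).2 hy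
  have := hy'.quot_ofList_smul_nontrivial ⊤
  -- `Ext^j(k, M)` vanishes for `j < |zs|`, hence `Ext^i(k, M/ysM)` vanishes for `i < |zs| - |ys|`,
  -- which yields a regular sequence of that length.
  obtain ⟨ws, hlen', hws, hreg⟩ := ModuleCat.exists_isRegular_of_exists_subsingleton_ext
    (maximalIdeal R) (zs.length - ys.length)
    (ModuleCat.of R (M ⧸ (Ideal.ofList ys • ⊤ : Submodule R M))) maximalIdeal_smul_top_lt
    (ModuleCat.of R (R ⧸ maximalIdeal R)) support_quotient_maximalIdeal fun i hi =>
      subsingleton_ext_quotient_of_isWeaklyRegular hy fun j _ hj =>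
        subsingleton_ext_residueField_of_isRegular hzs hz (by omega)
  refine ⟨ws, hws, hreg, ?_, by simp; omega⟩
  refine (IsLocalRing.isRegular_iff_isWeaklyRegular_of_subset_maximalIdeal ?_).2
    ((isWeaklyRegular_append_iff M ys ws).2 ⟨hy, hreg.toIsWeaklyRegular⟩)
  intro r hr
  rcases List.mem_append.1 hr with h | h
  exacts [hys r h, hws r h]

/-- Let `N` be the submodule killed by `p`. If `N ⊆ rM`, regularity of `r` gives `N = rN`, so `N =
0` by Nakayama, which is absurd. Some element of `N` therefore has a nonzero class modulo `r`,
killed by both `p` and `r`. -/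
theorem exists_associatedPrime_quotSMulTop [Module.Finite R M] {r : R} (hr : IsSMulRegular M r)
    (hrm : r ∈ maximalIdeal R) {p : Ideal R} (hp : p ∈ associatedPrimes R M) :
    ∃ q ∈ associatedPrimes R (QuotSMulTop r M), p ≤ q ∧ r ∈ q := by
  obtain ⟨m, hm, hpm⟩ : ∃ m : M, m ≠ 0 ∧ ∀ a ∈ p, a • m = 0 := by
    obtain ⟨hprime, m, rfl⟩ := isAssociatedPrime_iff.1 hp
    refine ⟨m, ?_, fun a ha => Submodule.mem_colon_singleton.1 ha⟩
    rintro rfl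
    exact hprime.ne_top (by ext; simp)
  let N : Submodule R M := Submodule.torsionBySet R M p
  have hN : ¬ N ≤ r • (⊤ : Submodule R M) := by
    intro hle
    have hbot : N = ⊥ := by
      refine Submodule.eq_bot_of_le_smul_of_le_jacobson_bot (Ideal.span {r}) N
        (IsNoetherian.noetherian N) (fun n hn => ?_) ?_
      · obtain ⟨l, -, rfl⟩ := (Submodule.mem_smul_pointwise_iff_exists _ _ _).1 (hle hn)
        refine Submodule.smul_mem_smul (Ideal.mem_span_singleton_self r) ?_
        refine (Submodule.mem_torsionBySet_iff _ _).2 fun a => hr.right_eq_zero_of_smul ?_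
        rw [smul_comm]
        exact (Submodule.mem_torsionBySet_iff _ _).1 hn a
      · rw [Ideal.span_singleton_le_iff_mem]
        exact maximalIdeal_le_jacobson _ hrm
    exact hm ((Submodule.eq_bot_iff _).1 hbot m
      ((Submodule.mem_torsionBySet_iff _ _).2 fun a => hpm a a.2))
  obtain ⟨n, hn, hnr⟩ := SetLike.not_le_iff_exists.1 hN
  have hne : (Submodule.Quotient.mk n : QuotSMulTop r M) ≠ 0 := fun h =>
    hnr ((Submodule.Quotient.mk_eq_zero _).1 h)
  obtain ⟨q, hq, hle⟩ := exists_le_isAssociatedPrime_of_isNoetherianRing R _ hne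
  refine ⟨q, hq, fun a ha => hle ?_, hle ?_⟩
  · refine Submodule.mem_colon_singleton.2 ?_
    rw [← Submodule.Quotient.mk_smul, (Submodule.mem_torsionBySet_iff _ _).1 hn ⟨a, ha⟩]
    exact zero_mem _
  · refine Submodule.mem_colon_singleton.2 ((Submodule.Quotient.mk_eq_zero _).2 ?_)
    exact Submodule.smul_mem_pointwise_smul _ _ _ trivial

/-- Each regular element lies outside `p` but inside a larger prime associated to the quotient, so
the dimension drops by at least one each time. -/
theorem length_le_ringKrullDim_quotient [Module.Finite R M] {zs : List R}
    (hzs : ∀ z ∈ zs, z ∈ maximalIdeal R) (h : IsWeaklyRegular M zs) {p : Ideal R}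
    (hp : p ∈ associatedPrimes R M) : (zs.length : WithBot ℕ∞) ≤ ringKrullDim (R ⧸ p) := by
  induction zs generalizing M p with
  | nil =>
    have : p.IsPrime := hp.1
    simpa using ringKrullDim_nonneg_of_nontrivial
  | cons r zs ih =>
    rw [isWeaklyRegular_cons_iff] at h
    obtain ⟨q, hq, hpq, hrq⟩ := exists_associatedPrime_quotSMulTop h.1 (hzs r (by simp)) hp
    have : p.IsPrime := hp.1
    have hrp : r ∉ p := fun hrp => by
      have : r ∈ ⋃ p ∈ associatedPrimes R M, (p : Set R) := Set.mem_biUnion hp hrp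
      rw [biUnion_associatedPrimes_eq_compl_regular] at this
      exact this h.1
    have hle := ringKrullDim_succ_le_of_surjective (Ideal.Quotient.factor hpq)
      (Ideal.Quotient.factor_surjective hpq) (r := Ideal.Quotient.mk p r)
      (mem_nonZeroDivisors_of_ne_zero fun h => hrp (Ideal.Quotient.eq_zero_iff_mem.1 h))
      (by simpa using Ideal.Quotient.eq_zero_iff_mem.2 hrq)
    refine le_trans ?_ hle
    rw [List.length_cons, Nat.cast_add, Nat.cast_one]
    gcongr
    exact ih (fun z hz => hzs z (by simp [hz])) h.2 hq

theorem length_le_of_isRegular {ys : List R} (h : IsRegular R ys) {n : ℕ}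
    (hdim : (n : WithBot ℕ∞) = ringKrullDim R) : ys.length ≤ n := by
  have hdimy := ringKrullDim_add_length_eq_ringKrullDim_of_isRegular _ h
  have : Nontrivial (R ⧸ Ideal.ofList ys) := by
    refine Ideal.Quotient.nontrivial_iff.2 fun htop => h.top_ne_smul ?_
    rw [htop, Submodule.top_smul]
  have h₀ := add_le_add_left (ringKrullDim_nonneg_of_nontrivial (R := R ⧸ Ideal.ofList ys))
    (ys.length : WithBot ℕ∞)
  rw [hdimy, zero_add, ← hdim] at h₀
  exact_mod_cast h₀

/-- A regular sequence of the ring is regular on every maximal Cohen-Macaulay module. -/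
theorem IsMaximalCohenMacaulay.isRegular (hM : IsMaximalCohenMacaulay R M) {ys : List R}
    (h : IsRegular R ys) : IsRegular M ys := by
  obtain ⟨hfin, zs, hzs, hz, hdim⟩ := hM
  have := hz.nontrivial
  have hys := mem_maximalIdeal_of_isRegular h
  rw [IsLocalRing.isRegular_iff_isWeaklyRegular_of_subset_maximalIdeal hys]
  induction ys using List.reverseRecOn with
  | nil => exact IsWeaklyRegular.nil R M
  | append_singleton ys y ih =>
    have hdimy := ringKrullDim_add_length_eq_ringKrullDim_of_isRegular _ h
    have hwr := (isWeaklyRegular_append_iff _ _ _).1 h.toIsWeaklyRegular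
    have hys' : ∀ a ∈ ys, a ∈ maximalIdeal R := fun a ha => hys a (by simp [ha])
    have hyM := ih ((IsLocalRing.isRegular_iff_isWeaklyRegular_of_subset_maximalIdeal hys').2 hwr.1)
      hys'
    refine (isWeaklyRegular_append_iff _ _ _).2 ⟨hyM, (isWeaklyRegular_singleton_iff _ _).2 ?_⟩
    by_contra hreg
    have hmem : y ∈ ⋃ p ∈ associatedPrimes R (M ⧸ (Ideal.ofList ys • ⊤ : Submodule R M)),
        (p : Set R) := by
      rw [biUnion_associatedPrimes_eq_compl_regular]
      exact hreg
    obtain ⟨p, hp, hyp⟩ := Set.mem_iUnion₂.1 hmem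
    have hle : Ideal.ofList (ys ++ [y]) ≤ p := by
      rw [Ideal.ofList_append, Ideal.ofList_singleton, sup_le_iff, Ideal.span_singleton_le_iff_mem]
      refine ⟨fun a ha => ?_, hyp⟩
      refine hp.annihilator_le (Submodule.mem_annihilator.2 fun m _ => ?_)
      obtain ⟨m, rfl⟩ := Submodule.Quotient.mk_surjective _ m
      exact (Submodule.Quotient.mk_eq_zero _).2 (Submodule.smul_mem_smul ha trivial)
    have hp' : p.IsPrime := hp.1
    have hlen : ys.length ≤ zs.length := by
      have := length_le_of_isRegular h hdim
      simp at this
      omega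
    obtain ⟨ws, hws, hreg', -, hlen'⟩ := exists_isRegular_append hys' hyM hzs hz hlen
    -- If `y` were a zero divisor on `M/ysM`, then `dim R - |ys| = |ws| ≤ dim R/p ≤ dim R/(ys, y) =
    -- dim R - |ys| - 1`.
    have h₁ := length_le_ringKrullDim_quotient hws hreg'.toIsWeaklyRegular hp
    have h₂ := ringKrullDim_le_of_surjective _ (Ideal.Quotient.factor_surjective hle)
    have h₃ := (add_le_add_left (h₁.trans h₂) ((ys ++ [y]).length : WithBot ℕ∞)).trans hdimy.le
    rw [← hdim, ← Nat.cast_add, Nat.cast_le] at h₃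
    simp at h₃ hlen'
    omega

end Depth

/-! ### Rees' theorem and vanishing of Ext. -/

section ExtVanishing

variable {R : Type u} [CommRing R]
variable {N N' M W : Type u} [AddCommGroup N] [AddCommGroup N'] [AddCommGroup M] [AddCommGroup W]
  [Module R N] [Module R N'] [Module R M] [Module R W]

theorem δsmul_surjective {z : R} (hz : IsSMulRegular W z) (hzN : z ∈ Module.annihilator R N)
    (n : ℕ) : Function.Surjective (ModuleExt.δsmul hz N n) := fun e =>
  (ModuleExt.exact_δsmul_smul hz n e).1 (ModuleExt.smul_eq_zero_of_mem_annihilator hzN e)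

theorem δsmul_injective {z : R} (hz : IsSMulRegular W z) (n : ℕ)
    (h : Subsingleton (ModuleExt R N W n)) : Function.Injective (ModuleExt.δsmul hz N n) := by
  rw [← LinearMap.ker_eq_bot, LinearMap.ker_eq_bot']
  intro e he
  obtain ⟨a, rfl⟩ := (ModuleExt.exact_map_δsmul hz n e).1 he
  rw [Subsingleton.elim a 0, map_zero]

theorem subsingleton_ext_of_mem_annihilator {zs : List R} (hzs : IsWeaklyRegular W zs)
    (hN : ∀ z ∈ zs, z ∈ Module.annihilator R N) {j : ℕ} (hj : j < zs.length) :
    Subsingleton (ModuleExt R N W j) := by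
  induction zs generalizing W j with
  | nil => simp at hj
  | cons z zs ih =>
    rw [isWeaklyRegular_cons_iff] at hzs
    cases j with
    | zero =>
      refine (ModuleExt.homEquiv (R := R) (N := N) (M := W)).toEquiv.subsingleton_congr.2
        (subsingleton_of_forall_eq 0 fun f => ?_)
      ext n
      refine hzs.1.right_eq_zero_of_smul ?_
      rw [← map_smul, Module.mem_annihilator.1 (hN z (by simp)) n, map_zero]
    | succ j =>
      have := ih hzs.2 (fun a ha => hN a (by simp [ha])) (by simpa using hj)
      exact (δsmul_surjective hzs.1 (hN z (by simp)) j).subsingleton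

/-- **Rees' theorem**: if `zs` is regular on `W` and kills `N`, then `Ext` in degree the length of
`zs` is the module of linear maps into `W ⧸ zs W`. -/
theorem nonempty_ext_equiv_hom {zs : List R} (hzs : IsWeaklyRegular W zs)
    (hN : ∀ z ∈ zs, z ∈ Module.annihilator R N) :
    Nonempty (ModuleExt R N W zs.length ≃ₗ[R]
      (N →ₗ[R] W ⧸ (Ideal.ofList zs • ⊤ : Submodule R W))) := by
  induction zs generalizing W with
  | nil =>
    exact ⟨ModuleExt.homEquiv.trans
      (Submodule.quotEquivOfEqBot (Ideal.ofList ([] : List R) • ⊤ : Submodule R W)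
        (by simp)).symm.congrRight⟩
  | cons z zs ih =>
    have hvan := subsingleton_ext_of_mem_annihilator hzs hN (j := zs.length) (by simp)
    rw [isWeaklyRegular_cons_iff] at hzs
    obtain ⟨e⟩ := ih hzs.2 (fun a ha => hN a (by simp [ha]))
    let δ := LinearEquiv.ofBijective (ModuleExt.δsmul hzs.1 N zs.length)
      ⟨δsmul_injective hzs.1 _ hvan, δsmul_surjective hzs.1 (hN z (by simp)) _⟩
    exact ⟨(δ.symm.trans e).trans
      (Submodule.quotOfListConsSMulTopEquivQuotSMulTopInner W z zs).symm.congrRight⟩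

/-- This replaces naturality of the Rees isomorphism. Surjectivity descends one degree at a time
through the boundary maps, which commute with `comap`, are onto for `N` and injective for `N'`. -/
theorem exists_extension_of_comap_surjective {zs : List R} (hzs : IsWeaklyRegular W zs)
    (hN : ∀ z ∈ zs, z ∈ Module.annihilator R N) (hN' : ∀ z ∈ zs, z ∈ Module.annihilator R N')
    (i : N' →ₗ[R] N) (hi : Function.Surjective (ModuleExt.comap i W zs.length))
    (g : N' →ₗ[R] W ⧸ (Ideal.ofList zs • ⊤ : Submodule R W)) :
    ∃ h : N →ₗ[R] W ⧸ (Ideal.ofList zs • ⊤ : Submodule R W), h ∘ₗ i = g := by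
  induction zs generalizing W with
  | nil =>
    let e := Submodule.quotEquivOfEqBot (Ideal.ofList ([] : List R) • ⊤ : Submodule R W) (by simp)
    obtain ⟨c, hc⟩ := hi (ModuleExt.homEquiv.symm (e.toLinearMap ∘ₗ g))
    refine ⟨e.symm.toLinearMap ∘ₗ ModuleExt.homEquiv c, ?_⟩
    rw [LinearMap.comp_assoc]
    have := ModuleExt.homEquiv_comap (M := W) i c
    refine (congrArg (fun f => e.symm.toLinearMap ∘ₗ f) (this.symm.trans
      ((congrArg ModuleExt.homEquiv hc).trans (LinearEquiv.apply_symm_apply _ _)))).trans ?_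
    ext x
    simp
  | cons z zs ih =>
    have hvan := subsingleton_ext_of_mem_annihilator hzs hN' (j := zs.length) (by simp)
    rw [isWeaklyRegular_cons_iff] at hzs
    let e := Submodule.quotOfListConsSMulTopEquivQuotSMulTopInner W z zs
    obtain ⟨h, hh⟩ := ih hzs.2 (fun a ha => hN a (by simp [ha])) (fun a ha => hN' a (by simp [ha]))
      (fun c' => by
        obtain ⟨c₁, hc₁⟩ := hi (ModuleExt.δsmul hzs.1 N' _ c')
        obtain ⟨c, rfl⟩ := δsmul_surjective hzs.1 (hN z (by simp)) _ c₁
        refine ⟨c, δsmul_injective hzs.1 _ hvan ?_⟩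
        rw [← ModuleExt.comap_δsmul]
        exact hc₁)
      (e.toLinearMap ∘ₗ g)
    refine ⟨e.symm.toLinearMap ∘ₗ h, ?_⟩
    rw [LinearMap.comp_assoc, hh]
    ext x
    simp

theorem exists_lift_of_subsingleton_ext {zs : List R} (hzs : IsWeaklyRegular W zs)
    (h : ∀ j, 1 ≤ j → Subsingleton (ModuleExt R N W j))
    (g : N →ₗ[R] W ⧸ (Ideal.ofList zs • ⊤ : Submodule R W)) :
    ∃ f : N →ₗ[R] W, (Ideal.ofList zs • ⊤ : Submodule R W).mkQ ∘ₗ f = g := by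
  induction zs generalizing W with
  | nil =>
    let e := Submodule.quotEquivOfEqBot (Ideal.ofList ([] : List R) • ⊤ : Submodule R W) (by simp)
    refine ⟨e.toLinearMap ∘ₗ g, ?_⟩
    ext x
    exact e.symm_apply_apply (g x)
  | cons z zs ih =>
    rw [isWeaklyRegular_cons_iff] at hzs
    let e := Submodule.quotOfListConsSMulTopEquivQuotSMulTopInner W z zs
    obtain ⟨f₁, hf₁⟩ := ih hzs.2 (fun j hj => subsingleton_ext_quotSMulTop hzs.1 j (h j hj)
      (h (j + 1) (by omega))) (e.toLinearMap ∘ₗ g)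
    have := h 1 le_rfl
    obtain ⟨a, ha⟩ := (ModuleExt.exact_map_δsmul hzs.1 0 (ModuleExt.homEquiv.symm f₁)).1
      (Subsingleton.elim _ _)
    refine ⟨ModuleExt.homEquiv a, ?_⟩
    replace ha := congrArg ModuleExt.homEquiv ha
    rw [ModuleExt.homEquiv_map, LinearEquiv.apply_symm_apply] at ha
    rw [← ha] at hf₁
    ext x
    apply e.injective
    exact LinearMap.congr_fun hf₁ x

/-- Quotients by regular sequences raise the degrees with non-vanishing `Ext` by at most the
length of the sequence. -/
theorem subsingleton_ext_quotient_left {zs : List R} (hzs : IsWeaklyRegular N zs) {i : ℕ}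
    (h : ∀ j, i < j → Subsingleton (ModuleExt R N W j)) {j : ℕ} (hj : i + zs.length < j) :
    Subsingleton (ModuleExt R (N ⧸ (Ideal.ofList zs • ⊤ : Submodule R N)) W j) := by
  induction zs generalizing N i with
  | nil =>
    have := h j (by simpa using hj)
    exact (ModuleExt.congrLeft (Submodule.quotEquivOfEqBot
      (Ideal.ofList ([] : List R) • ⊤ : Submodule R N) (by simp)) W j).symm.toEquiv.subsingleton
  | cons z zs ih =>
    rw [isWeaklyRegular_cons_iff] at hzs
    have := ih hzs.2 (i := i + 1) (fun j hj => by
      obtain ⟨j, rfl⟩ : ∃ j', j = j' + 1 := ⟨j - 1, by omega⟩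
      have h₁ := h j (by omega)
      have h₂ := h (j + 1) (by omega)
      exact subsingleton_of_exact (map_zero _) (ModuleExt.exact_coδ_comap (M := W)
        (f := z • LinearMap.id) (ModuleExt.smul_id_injective hzs.1)
        (LinearMap.exact_lsmul_mkQ_smul_top N z) (Submodule.mkQ_surjective _) j)) (by simp at hj; omega)
    exact (ModuleExt.congrLeft (Submodule.quotOfListConsSMulTopEquivQuotSMulTopInner N z zs)
      W j).symm.toEquiv.subsingleton

theorem subsingleton_ext_of_projective [Module.Projective R N] {j : ℕ} (hj : 0 < j) :
    Subsingleton (ModuleExt R N W j) := by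
  obtain ⟨j, rfl⟩ : ∃ j', j = j' + 1 := ⟨j - 1, by omega⟩
  have : Projective (ModuleCat.of R N) := inferInstance
  exact Ext.subsingleton_of_projective _ _ _

variable [IsLocalRing R]
open IsLocalRing

theorem nonempty_quotient_maximalIdeal_equiv [IsSimpleModule R N] :
    Nonempty (N ≃ₗ[R] R ⧸ maximalIdeal R) := by
  obtain ⟨I, hI, ⟨e⟩⟩ := (isSimpleModule_iff_quot_maximal (R := R) (M := N)).1 inferInstance
  obtain rfl := eq_maximalIdeal hI
  exact ⟨e⟩

theorem subsingleton_ext_of_isFiniteLength (hN : IsFiniteLength R N) {j : ℕ}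
    (h : Subsingleton (ModuleExt R (R ⧸ maximalIdeal R) W j)) :
    Subsingleton (ModuleExt R N W j) := by
  induction hN with
  | @of_subsingleton N _ _ _ =>
    refine subsingleton_of_forall_eq 0 fun e => ?_
    have : (LinearMap.id : N →ₗ[R] N) = 0 := LinearMap.ext fun _ => Subsingleton.elim _ _
    rw [← ModuleExt.comap_id j e, this, ModuleExt.comap_zero_apply]
  | @of_simple_quotient N _ _ K _ hK ih =>
    obtain ⟨e⟩ := nonempty_quotient_maximalIdeal_equiv (R := R) (N := N ⧸ K)
    have := (ModuleExt.congrLeft e W j).symm.toEquiv.subsingleton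
    exact subsingleton_of_exact (map_zero _) (ModuleExt.exact_comap_comap (M := W)
      K.injective_subtype (LinearMap.exact_subtype_mkQ K) K.mkQ_surjective j)

theorem exists_injective_of_isFiniteLength [Nontrivial N] (hN : IsFiniteLength R N) :
    ∃ f : (R ⧸ maximalIdeal R) →ₗ[R] N, Function.Injective f := by
  obtain ⟨_, _⟩ := isFiniteLength_iff_isNoetherian_isArtinian.1 hN
  obtain ⟨K, hK⟩ := IsAtomic.exists_atom (Submodule R N)
  have := isSimpleModule_iff_isAtom.2 hK
  obtain ⟨e⟩ := nonempty_quotient_maximalIdeal_equiv (R := R) (N := K)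
  exact ⟨K.subtype ∘ₗ e.symm.toLinearMap, K.injective_subtype.comp e.symm.injective⟩

/-- Descending induction from the injective dimension. The residue field embeds in `R/(zs)`, whose
Ext vanishes above degree `d`; the cokernel has finite length, so its Ext in degree `j + 1` vanishes
by induction and dévissage. -/
theorem subsingleton_ext_residueField_of_hasInjectiveDimensionLE {n d : ℕ}
    (hW : HasInjectiveDimensionLE (ModuleCat.of R W) n) {zs : List R} (hzs : IsWeaklyRegular R zs)
    (hlen : zs.length = d)
    (hfl : IsFiniteLength R (R ⧸ (Ideal.ofList zs • ⊤ : Submodule R R)))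
    [Nontrivial (R ⧸ (Ideal.ofList zs • ⊤ : Submodule R R))] {j : ℕ} (hj : d < j) :
    Subsingleton (ModuleExt R (R ⧸ maximalIdeal R) W j) := by
  obtain ⟨f, hf⟩ := exists_injective_of_isFiniteLength hfl
  obtain ⟨k, hk⟩ : ∃ k, n + 1 ≤ j + k := ⟨n + 1, by omega⟩
  induction k generalizing j with
  | zero => exact HasInjectiveDimensionLT.subsingleton (ModuleCat.of R W) (n + 1) j hk _
  | succ k ih =>
    have h₁ : Subsingleton (ModuleExt R (R ⧸ (Ideal.ofList zs • ⊤ : Submodule R R)) W j) :=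
      subsingleton_ext_quotient_left hzs (i := 0)
        (fun j hj => subsingleton_ext_of_projective hj) (by omega)
    have h₂ : Subsingleton (ModuleExt R (_ ⧸ LinearMap.range f) W (j + 1)) :=
      subsingleton_ext_of_isFiniteLength (hfl.of_surjective (Submodule.mkQ_surjective _))
        (ih (by omega) (by omega))
    exact subsingleton_of_exact (map_zero _) (ModuleExt.exact_comap_coδ (M := W) hf
      (LinearMap.exact_map_mkQ_range f) (Submodule.mkQ_surjective _) j)

/-- Vanishing of `Ext^{j+1}(M/zM, W)` makes `z` act surjectively on the finitely generated module
`Ext^j(M, W)`, and Nakayama applies. -/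
theorem subsingleton_ext_of_quotient [IsNoetherianRing R] [Module.Finite R M] [Module.Finite R W]
    {zs : List R} (hzs : IsWeaklyRegular M zs) (hzm : ∀ z ∈ zs, z ∈ maximalIdeal R) {i : ℕ}
    (h : ∀ j, i + zs.length < j →
      Subsingleton (ModuleExt R (M ⧸ (Ideal.ofList zs • ⊤ : Submodule R M)) W j)) {j : ℕ}
    (hj : i < j) : Subsingleton (ModuleExt R M W j) := by
  induction zs generalizing M i j with
  | nil =>
    have := h j (by simpa using hj)
    exact (ModuleExt.congrLeft (Submodule.quotEquivOfEqBot
      (Ideal.ofList ([] : List R) • ⊤ : Submodule R M) (by simp)) W j).toEquiv.subsingleton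
  | cons z zs ih =>
    rw [isWeaklyRegular_cons_iff] at hzs
    have := ih (M := QuotSMulTop z M) hzs.2 (fun a ha => hzm a (by simp [ha])) (i := i + 1)
      (fun j hj => by
        have := h j (by simp; omega)
        exact (ModuleExt.congrLeft (Submodule.quotOfListConsSMulTopEquivQuotSMulTopInner M z zs)
          W j).toEquiv.subsingleton) (j := j + 1) (by omega)
    have hex := ModuleExt.exact_comap_coδ (M := W)
        (f := z • LinearMap.id) (ModuleExt.smul_id_injective hzs.1)
        (LinearMap.exact_lsmul_mkQ_smul_top M z) (Submodule.mkQ_surjective _) j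
    have hfin : Module.Finite R (ModuleExt R M W j) :=
      ModuleCat.finite_ext R (ModuleCat.of R M) (ModuleCat.of R W) j
    have htop : (⊤ : Submodule R (ModuleExt R M W j)) = ⊥ := by
      refine Submodule.eq_bot_of_le_smul_of_le_jacobson_bot (Ideal.span {z}) ⊤ hfin.1
        (fun e _ => ?_) ?_
      · obtain ⟨c, rfl⟩ := (hex e).1 (Subsingleton.elim _ _)
        rw [ModuleExt.comap_smul_id]
        exact Submodule.smul_mem_smul (Ideal.mem_span_singleton_self z) trivial
      · rw [Ideal.span_singleton_le_iff_mem]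
        exact maximalIdeal_le_jacobson _ (hzm z (by simp))
    exact (Submodule.subsingleton_iff R).1 (subsingleton_of_bot_eq_top htop.symm)

end ExtVanishing

theorem traceIdeal_le_of_surjective {R M N : Type u} [CommRing R] [AddCommGroup M] [AddCommGroup N]
    [Module R M] [Module R N] {f : M →ₗ[R] N} (hf : Function.Surjective f) :
    traceIdeal R N ≤ traceIdeal R M := by
  refine iSup_le fun g => le_iSup_of_le (g ∘ₗ f) ?_
  rw [LinearMap.range_comp_of_range_eq_top _ (LinearMap.range_eq_top.2 hf)]

theorem ofList_le_annihilator_quotient {R M : Type*} [CommRing R] [AddCommGroup M]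
    [Module R M] (zs : List R) :
    ∀ z ∈ zs, z ∈ Module.annihilator R (M ⧸ (Ideal.ofList zs • ⊤ : Submodule R M)) := by
  intro z hz
  refine Module.mem_annihilator.2 fun m => ?_
  obtain ⟨m, rfl⟩ := Submodule.Quotient.mk_surjective _ m
  exact (Submodule.Quotient.mk_eq_zero _).2
    (Submodule.smul_mem_smul (Ideal.subset_span hz) trivial)

/-! ### Simple socles and type one. -/

section Socle

open IsLocalRing

/-- The socle of `M` is a simple module. -/
def HasSimpleSocle (R : Type*) [CommRing R] [IsLocalRing R] (M : Type*) [AddCommGroup M]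
    [Module R M] : Prop :=
  ∃ s : M, s ≠ 0 ∧ (∀ a ∈ maximalIdeal R, a • s = 0) ∧
    ∀ t : M, (∀ a ∈ maximalIdeal R, a • t = 0) → ∃ c : R, t = c • s

variable {R : Type u} [CommRing R] [IsLocalRing R]
variable {M N W V : Type u} [AddCommGroup M] [AddCommGroup N] [AddCommGroup W] [AddCommGroup V]
  [Module R M] [Module R N] [Module R W] [Module R V]

/-- The map from the residue field that picks out an element of the socle. -/
def residueFieldToModule (s : M) (hs : ∀ a ∈ maximalIdeal R, a • s = 0) :
    (R ⧸ maximalIdeal R) →ₗ[R] M :=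
  (maximalIdeal R).liftQ (LinearMap.toSpanSingleton R M s) fun a ha => hs a ha

theorem residueFieldToModule_mk (s : M) (hs : ∀ a ∈ maximalIdeal R, a • s = 0) (c : R) :
    residueFieldToModule s hs (Submodule.Quotient.mk c) = c • s := rfl

theorem residueFieldToModule_injective {s : M} (hs : ∀ a ∈ maximalIdeal R, a • s = 0)
    (hs₀ : s ≠ 0) : Function.Injective (residueFieldToModule s hs) := by
  rw [← LinearMap.ker_eq_bot, LinearMap.ker_eq_bot']
  intro c hc
  obtain ⟨c, rfl⟩ := Submodule.Quotient.mk_surjective _ c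
  rw [residueFieldToModule_mk] at hc
  refine (Submodule.Quotient.mk_eq_zero _).2 ?_
  by_contra hcm
  exact hs₀ (((notMem_maximalIdeal.1 hcm).smul_eq_zero).1 hc)

theorem smul_hom_residueField_apply (f : (R ⧸ maximalIdeal R) →ₗ[R] M) {a : R}
    (ha : a ∈ maximalIdeal R) (x : R ⧸ maximalIdeal R) : a • f x = 0 := by
  obtain ⟨x, rfl⟩ := Submodule.Quotient.mk_surjective _ x
  rw [← map_smul, ← Submodule.Quotient.mk_smul,
    (Submodule.Quotient.mk_eq_zero _).2 (show a • x ∈ maximalIdeal R from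
      Ideal.mul_mem_right x _ ha), map_zero]

theorem hasSimpleSocle_iff_nonempty_equiv : HasSimpleSocle R M ↔
    Nonempty (((R ⧸ maximalIdeal R) →ₗ[R] M) ≃ₗ[R] R ⧸ maximalIdeal R) := by
  constructor
  · rintro ⟨s, hs₀, hs, hsoc⟩
    let φ : R →ₗ[R] (R ⧸ maximalIdeal R) →ₗ[R] M :=
      LinearMap.toSpanSingleton R _ (residueFieldToModule s hs)
    have hφ (c x : R) : φ c (Submodule.Quotient.mk x) = c • x • s := rfl
    have hsurj : Function.Surjective φ := by
      intro f
      obtain ⟨c, hc⟩ := hsoc (f (Submodule.Quotient.mk 1)) fun a ha =>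
        smul_hom_residueField_apply f ha _
      refine ⟨c, LinearMap.ext fun x => ?_⟩
      obtain ⟨x, rfl⟩ := Submodule.Quotient.mk_surjective _ x
      rw [hφ, smul_comm, ← hc, ← map_smul, ← Submodule.Quotient.mk_smul, smul_eq_mul, mul_one]
    have hker : LinearMap.ker φ = maximalIdeal R := by
      ext c
      rw [LinearMap.mem_ker]
      constructor
      · intro hc
        by_contra hcm
        have := (hφ c 1).symm.trans (LinearMap.congr_fun hc _)
        rw [one_smul] at this
        exact hs₀ (((notMem_maximalIdeal.1 hcm).smul_eq_zero).1 this)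
      · intro hc
        refine LinearMap.ext fun x => ?_
        obtain ⟨x, rfl⟩ := Submodule.Quotient.mk_surjective _ x
        rw [hφ, smul_comm, hs c hc, smul_zero, LinearMap.zero_apply]
    exact ⟨((Submodule.quotEquivOfEq _ _ hker).symm.trans
      (φ.quotKerEquivOfSurjective hsurj)).symm⟩
  · rintro ⟨e⟩
    let φ := e.symm (Submodule.Quotient.mk 1)
    refine ⟨φ (Submodule.Quotient.mk 1), fun h => ?_, fun a ha =>
      smul_hom_residueField_apply φ ha _, fun t ht => ?_⟩
    · have hφ : φ = 0 := by
        refine LinearMap.ext fun x => ?_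
        obtain ⟨x, rfl⟩ := Submodule.Quotient.mk_surjective _ x
        rw [← mul_one x, ← smul_eq_mul, Submodule.Quotient.mk_smul, map_smul, h, smul_zero,
          LinearMap.zero_apply]
      have h1 : (Submodule.Quotient.mk 1 : R ⧸ maximalIdeal R) = 0 := by
        rw [← e.apply_symm_apply (Submodule.Quotient.mk 1), show e.symm _ = 0 from hφ, map_zero]
      exact (maximalIdeal.isMaximal R).ne_top
        ((Ideal.eq_top_iff_one _).2 ((Submodule.Quotient.mk_eq_zero _).1 h1))
    · obtain ⟨c, hc⟩ := Submodule.Quotient.mk_surjective _ (e (residueFieldToModule t ht))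
      refine ⟨c, ?_⟩
      have hψ : residueFieldToModule t ht = c • φ := by
        apply e.injective
        rw [map_smul, e.apply_symm_apply, ← hc, ← Submodule.Quotient.mk_smul, smul_eq_mul, mul_one]
      rw [← LinearMap.smul_apply, ← hψ, residueFieldToModule_mk, one_smul]

theorem HasSimpleSocle.congr (e : M ≃ₗ[R] N) (h : HasSimpleSocle R M) : HasSimpleSocle R N := by
  obtain ⟨s, hs₀, hs, hsoc⟩ := h
  refine ⟨e s, by simpa using hs₀, fun a ha => by rw [← map_smul, hs a ha, map_zero],
    fun t ht => ?_⟩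
  obtain ⟨c, hc⟩ := hsoc (e.symm t) fun a ha => by rw [← map_smul, ht a ha, map_zero]
  exact ⟨c, by rw [← map_smul, ← hc, e.apply_symm_apply]⟩

/-- The elementwise form of the socle condition passes between `R` and `S` without comparing Ext
over the two rings. -/
theorem hasSimpleSocle_iff_of_surjective {R S M : Type*} [CommRing R] [IsLocalRing R] [CommRing S]
    [IsLocalRing S] [Algebra R S] [AddCommGroup M] [Module R M] [Module S M] [IsScalarTower R S M]
    (h : Function.Surjective (algebraMap R S)) : HasSimpleSocle R M ↔ HasSimpleSocle S M := by
  have hloc : IsLocalHom (algebraMap R S) := h.isLocalHom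
  have key (t : M) : (∀ a ∈ maximalIdeal R, a • t = 0) ↔ ∀ a ∈ maximalIdeal S, a • t = 0 := by
    have hmem (a : R) : algebraMap R S a ∈ maximalIdeal S ↔ a ∈ maximalIdeal R := by
      rw [mem_maximalIdeal, mem_maximalIdeal, mem_nonunits_iff, mem_nonunits_iff, isUnit_map_iff]
    refine ⟨fun ht b hb => ?_, fun ht a ha => ?_⟩
    · obtain ⟨a, rfl⟩ := h b
      rw [algebraMap_smul, ht a ((hmem a).1 hb)]
    · rw [← algebraMap_smul S, ht _ ((hmem a).2 ha)]
  refine exists_congr fun s => and_congr_right fun _ => and_congr (key s) <|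
    forall_congr' fun t => imp_congr (key t) ⟨?_, ?_⟩
  · rintro ⟨c, rfl⟩
    exact ⟨algebraMap R S c, (algebraMap_smul S c s).symm⟩
  · rintro ⟨c, rfl⟩
    obtain ⟨c, rfl⟩ := h c
    exact ⟨c, algebraMap_smul S c s⟩

theorem nonempty_ext_residueField_equiv_iff {zs : List R} (hzs : IsWeaklyRegular W zs)
    (hzm : ∀ z ∈ zs, z ∈ maximalIdeal R) :
    Nonempty (ModuleExt R (ResidueField R) W zs.length ≃ₗ[R] ResidueField R) ↔
      HasSimpleSocle R (W ⧸ (Ideal.ofList zs • ⊤ : Submodule R W)) := by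
  obtain ⟨e⟩ := nonempty_ext_equiv_hom (N := R ⧸ maximalIdeal R) hzs fun z hz => by
    rw [Ideal.annihilator_quotient]
    exact hzm z hz
  rw [hasSimpleSocle_iff_nonempty_equiv]
  exact ⟨fun ⟨f⟩ => ⟨e.symm.trans f⟩, fun ⟨f⟩ => ⟨e.trans f⟩⟩

/-- A nonzero kernel, having finite length, contains a copy of the residue field, hence a nonzero
multiple of `s`. -/
theorem injective_of_socle (hM : IsFiniteLength R M) {s : M}
    (hsoc : ∀ t : M, (∀ a ∈ maximalIdeal R, a • t = 0) → ∃ c : R, t = c • s)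
    (hs : ∀ a ∈ maximalIdeal R, a • s = 0) (h : M →ₗ[R] N) (hhs : h s ≠ 0) :
    Function.Injective h := by
  rw [← LinearMap.ker_eq_bot]
  by_contra hker
  have := Submodule.nontrivial_iff_ne_bot.2 hker
  obtain ⟨f, hf⟩ := exists_injective_of_isFiniteLength
    (hM.of_injective (LinearMap.ker h).injective_subtype)
  obtain ⟨c, hc⟩ := hsoc (f (Submodule.Quotient.mk 1)) fun a ha => by
    rw [← Submodule.coe_smul, smul_hom_residueField_apply f ha, Submodule.coe_zero]
  have hcs : c • h s = 0 := by rw [← map_smul, ← hc]; exact (f _).2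
  have hcm : c ∈ maximalIdeal R := by
    by_contra hcm
    exact hhs (((notMem_maximalIdeal.1 hcm).smul_eq_zero).1 hcs)
  rw [hs c hcm] at hc
  have h1 : (Submodule.Quotient.mk 1 : R ⧸ maximalIdeal R) = 0 :=
    hf (by rw [map_zero]; exact Subtype.ext hc)
  exact (maximalIdeal.isMaximal R).ne_top
    ((Ideal.eq_top_iff_one _).2 ((Submodule.Quotient.mk_eq_zero _).1 h1))

end Socle

/-! ### Canonical modules have a common trace ideal. -/

section Uniqueness
open IsLocalRing

variable {R : Type u} [CommRing R] [IsLocalRing R]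
variable {W V : Type u} [AddCommGroup W] [AddCommGroup V] [Module R W] [Module R V]

theorem isFiniteLength_quotient_ofList [IsNoetherianRing R] {M : Type*} [AddCommGroup M]
    [Module R M] [Module.Finite R M] {zs : List R} (h : IsRegular R zs)
    (hdim : (zs.length : WithBot ℕ∞) = ringKrullDim R) :
    IsFiniteLength R (M ⧸ (Ideal.ofList zs • ⊤ : Submodule R M)) := by
  have hd := ringKrullDim_add_length_eq_ringKrullDim_of_isRegular _ h
  have hart : IsArtinianRing (R ⧸ Ideal.ofList zs) := by
    rw [isArtinianRing_iff_isNoetherianRing_krullDimLE_zero]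
    refine ⟨inferInstance, ?_⟩
    rw [Ring.krullDimLE_iff]
    rw [← hdim] at hd
    cases hx : ringKrullDim (R ⧸ Ideal.ofList zs) with
    | bot => exact bot_le
    | coe e =>
      rw [hx] at hd
      norm_cast at hd ⊢
      exact (ENat.add_left_injective_of_ne_top (ENat.natCast_ne_top zs.length)
        (hd.trans (zero_add _).symm)).le
  have : Module.Finite (R ⧸ Ideal.ofList zs) (M ⧸ (Ideal.ofList zs • ⊤ : Submodule R M)) :=
    Module.Finite.of_restrictScalars_finite R _ _
  exact isFiniteLength_iff_isNoetherian_isArtinian.2 ⟨inferInstance,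
    isArtinian_of_surjective_algebraMap (R := R ⧸ Ideal.ofList zs) Ideal.Quotient.mk_surjective⟩

variable [IsNoetherianRing R]

theorem IsCanonicalModule.subsingleton_ext_of_isFiniteLength (hW : IsCanonicalModule R W)
    {zs : List R} (h : IsRegular R zs) (hdim : (zs.length : WithBot ℕ∞) = ringKrullDim R)
    {N : Type u} [AddCommGroup N] [Module R N] (hN : IsFiniteLength R N) {j : ℕ}
    (hj : zs.length < j) : Subsingleton (ModuleExt R N W j) := by
  obtain ⟨n, hn⟩ := hW.finite_injectiveDimension
  have := h.quot_ofList_smul_nontrivial ⊤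
  exact _root_.subsingleton_ext_of_isFiniteLength hN
    (subsingleton_ext_residueField_of_hasInjectiveDimensionLE hn h.toIsWeaklyRegular rfl
      (isFiniteLength_quotient_ofList h hdim) hj)

theorem IsCanonicalModule.subsingleton_ext (hW : IsCanonicalModule R W)
    {zs : List R} (h : IsRegular R zs) (hdim : (zs.length : WithBot ℕ∞) = ringKrullDim R)
    {M : Type u} [AddCommGroup M] [Module R M] (hM : IsMaximalCohenMacaulay R M) {j : ℕ}
    (hj : 1 ≤ j) : Subsingleton (ModuleExt R M W j) := by
  have := hM.finite
  have := hW.maximalCohenMacaulay.finite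
  exact subsingleton_ext_of_quotient (i := 0) (hM.isRegular h).toIsWeaklyRegular
    (mem_maximalIdeal_of_isRegular h) (fun j hj => hW.subsingleton_ext_of_isFiniteLength h hdim
      (isFiniteLength_quotient_ofList h hdim) (by omega)) hj

theorem IsCanonicalModule.hasSimpleSocle (hW : IsCanonicalModule R W)
    {zs : List R} (h : IsRegular R zs) (hdim : (zs.length : WithBot ℕ∞) = ringKrullDim R) :
    HasSimpleSocle R (W ⧸ (Ideal.ofList zs • ⊤ : Submodule R W)) :=
  (nonempty_ext_residueField_equiv_iff
    (hW.maximalCohenMacaulay.isRegular h).toIsWeaklyRegular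
    (mem_maximalIdeal_of_isRegular h)).1 (hW.type_one _ hdim.symm)

theorem IsCanonicalModule.exists_injective_quotient (hW : IsCanonicalModule R W)
    (hV : IsCanonicalModule R V) {zs : List R} (h : IsRegular R zs)
    (hdim : (zs.length : WithBot ℕ∞) = ringKrullDim R) :
    ∃ f : (W ⧸ (Ideal.ofList zs • ⊤ : Submodule R W)) →ₗ[R]
      V ⧸ (Ideal.ofList zs • ⊤ : Submodule R V), Function.Injective f := by
  have := hW.maximalCohenMacaulay.finite
  obtain ⟨s, hs₀, hs, hsoc⟩ := hW.hasSimpleSocle h hdim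
  obtain ⟨t, ht₀, ht, -⟩ := hV.hasSimpleSocle h hdim
  have hfl := isFiniteLength_quotient_ofList (M := W) h hdim
  have hi := residueFieldToModule_injective hs hs₀
  obtain ⟨f, hf⟩ := exists_extension_of_comap_surjective
    (hV.maximalCohenMacaulay.isRegular h).toIsWeaklyRegular
    (ofList_le_annihilator_quotient zs) (N' := R ⧸ maximalIdeal R) (fun z hz => by
      rw [Ideal.annihilator_quotient]
      exact mem_maximalIdeal_of_isRegular h z hz) (residueFieldToModule s hs) (fun e => by
      -- `Ext^{d+1}` of the cokernel of the socle inclusion into `V` vanishes, so restriction to the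
      -- socle is onto on `Ext^d`, with `d = |zs|`.
      have := hV.subsingleton_ext_of_isFiniteLength h hdim
        (hfl.of_surjective (Submodule.mkQ_surjective
          (LinearMap.range (residueFieldToModule s hs)))) (Nat.lt_succ_self _)
      exact (ModuleExt.exact_comap_coδ (M := V) hi (LinearMap.exact_map_mkQ_range _)
        (Submodule.mkQ_surjective _) zs.length e).1 (Subsingleton.elim _ _))
    (residueFieldToModule t ht)
  refine ⟨f, injective_of_socle hfl hsoc hs f ?_⟩
  have := LinearMap.congr_fun hf (Submodule.Quotient.mk 1)
  rw [LinearMap.comp_apply, residueFieldToModule_mk, residueFieldToModule_mk, one_smul,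
    one_smul] at this
  rwa [this]

/-- Modulo a maximal regular sequence each module embeds in the other, and finite length makes the
embeddings bijective. Since `Ext^j(W, V) = 0` for `j ≥ 1`, the map lifts to `W → V`, which is onto
by Nakayama. -/
theorem IsCanonicalModule.traceIdeal_le (hR : IsMaximalCohenMacaulay R R)
    (hW : IsCanonicalModule R W) (hV : IsCanonicalModule R V) :
    traceIdeal R V ≤ traceIdeal R W := by
  obtain ⟨-, zs, hzm, h, hdim⟩ := hR
  have := hV.maximalCohenMacaulay.finite
  obtain ⟨f, hf⟩ := hW.exists_injective_quotient hV h hdim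
  obtain ⟨g, hg⟩ := hV.exists_injective_quotient hW h hdim
  have hfl := isFiniteLength_quotient_ofList (M := V) h hdim
  obtain ⟨_, _⟩ := isFiniteLength_iff_isNoetherian_isArtinian.1 hfl
  have hsurj : Function.Surjective f :=
    Function.Surjective.of_comp (g := g)
      (IsArtinian.surjective_of_injective_endomorphism (f ∘ₗ g) (hf.comp hg))
  obtain ⟨φ, hφ⟩ := exists_lift_of_subsingleton_ext
    (hV.maximalCohenMacaulay.isRegular h).toIsWeaklyRegular
    (fun j hj => hV.subsingleton_ext h hdim hW.maximalCohenMacaulay hj)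
    (f ∘ₗ (Ideal.ofList zs • ⊤ : Submodule R W).mkQ)
  refine traceIdeal_le_of_surjective (f := φ) (LinearMap.range_eq_top.1 (top_le_iff.1 ?_))
  refine Submodule.le_of_le_smul_of_le_jacobson_bot (I := Ideal.ofList zs) Module.Finite.fg_top
    ((Ideal.span_le.2 hzm).trans (maximalIdeal_le_jacobson _)) fun v _ => ?_
  obtain ⟨w, hw⟩ := (hsurj.comp (Submodule.mkQ_surjective _)) (Submodule.Quotient.mk v)
  have hmem : v - φ w ∈ (Ideal.ofList zs • ⊤ : Submodule R V) := by
    refine (Submodule.Quotient.eq _).1 (hw.symm.trans ?_)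
    exact (LinearMap.congr_fun hφ w).symm
  rw [← add_sub_cancel (φ w) v]
  exact Submodule.add_mem_sup ⟨w, rfl⟩ hmem

end Uniqueness

/-! ### Change of rings to the quotient by a regular sequence. -/

section BaseChange

variable {R : Type u} [CommRing R] {ys : List R}

theorem smul_eq_zero_of_mem_ofList {X : Type*} [AddCommGroup X] [Module R X]
    [Module (R ⧸ Ideal.ofList ys) X] [IsScalarTower R (R ⧸ Ideal.ofList ys) X] {r : R}
    (hr : r ∈ Ideal.ofList ys) (x : X) : r • x = 0 := by
  rw [← algebraMap_smul (R ⧸ Ideal.ofList ys), Ideal.Quotient.algebraMap_eq,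
    Ideal.Quotient.eq_zero_iff_mem.2 hr, zero_smul]

/-- The linear map over `R ⧸ (ys)` induced on `M ⧸ ys M` by a linear map over `R`. -/
def liftQuotientOfList {M X : Type*} [AddCommGroup M] [Module R M] [AddCommGroup X] [Module R X]
    [Module (R ⧸ Ideal.ofList ys) X] [IsScalarTower R (R ⧸ Ideal.ofList ys) X] (f : M →ₗ[R] X) :
    (M ⧸ (Ideal.ofList ys • ⊤ : Submodule R M)) →ₗ[R ⧸ Ideal.ofList ys] X :=
  LinearMap.extendScalarsOfSurjective Ideal.Quotient.mk_surjective
    ((Ideal.ofList ys • ⊤ : Submodule R M).liftQ f (Submodule.smul_le.2 fun r hr m _ => by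
      rw [LinearMap.mem_ker, map_smul]
      exact smul_eq_zero_of_mem_ofList hr _))

theorem liftQuotientOfList_mk {M X : Type*} [AddCommGroup M] [Module R M] [AddCommGroup X]
    [Module R X] [Module (R ⧸ Ideal.ofList ys) X] [IsScalarTower R (R ⧸ Ideal.ofList ys) X]
    (f : M →ₗ[R] X) (m : M) :
    liftQuotientOfList (ys := ys) f (Submodule.Quotient.mk m) = f m := rfl

theorem projective_quotient_ofList {F : Type u} [AddCommGroup F] [Module R F]
    [Module.Projective R F] :
    Module.Projective (R ⧸ Ideal.ofList ys) (F ⧸ (Ideal.ofList ys • ⊤ : Submodule R F)) := by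
  refine Module.Projective.of_lifting_property'' fun f hf => ?_
  obtain ⟨g, hg⟩ := Module.projective_lifting_property (f.restrictScalars R)
    (Ideal.ofList ys • ⊤ : Submodule R F).mkQ hf
  refine ⟨liftQuotientOfList g, LinearMap.ext fun x => ?_⟩
  obtain ⟨x, rfl⟩ := Submodule.Quotient.mk_surjective _ x
  exact LinearMap.congr_fun hg x

theorem isWeaklyRegular_of_free {F : Type u} [AddCommGroup F] [Module R F] [Module.Flat R F]
    (h : IsWeaklyRegular R ys) : IsWeaklyRegular F ys :=
  ((TensorProduct.rid R F).isWeaklyRegular_congr ys).1 (h.isWeaklyRegular_lTensor (M₂ := F))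

variable {M : Type u} [AddCommGroup M] [Module R M]

/-- Vanishing of `Ext` over `R ⧸ (ys)` into `M ⧸ ys M`, from vanishing over `R` in higher degree. -/
theorem subsingleton_ext_quotient_ofList (hys : IsWeaklyRegular R ys) (hM : IsWeaklyRegular M ys)
    (i : ℕ) (X : Type u) [AddCommGroup X] [Module R X] [Module (R ⧸ Ideal.ofList ys) X]
    [IsScalarTower R (R ⧸ Ideal.ofList ys) X]
    (h : Subsingleton (ModuleExt R X M (ys.length + i + 1))) :
    Subsingleton (ModuleExt (R ⧸ Ideal.ofList ys) X
      (M ⧸ (Ideal.ofList ys • ⊤ : Submodule R M)) (i + 1)) := by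
  induction i generalizing X with
  | zero =>
    let F := X →₀ R
    let P := F ⧸ (Ideal.ofList ys • ⊤ : Submodule R F)
    have hP : Module.Projective (R ⧸ Ideal.ofList ys) P := projective_quotient_ofList
    let p : P →ₗ[R ⧸ Ideal.ofList ys] X := liftQuotientOfList (Finsupp.linearCombination R id)
    have hp : Function.Surjective p := fun x =>
      ⟨Submodule.Quotient.mk (Finsupp.single x 1), by
        rw [liftQuotientOfList_mk, Finsupp.linearCombination_single, one_smul, id]⟩
    let K := LinearMap.ker p
    have hK := LinearMap.exact_subtype_ker_map p
    refine subsingleton_of_forall_eq 0 fun e => ?_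
    have hvan := subsingleton_ext_of_projective (R := R ⧸ Ideal.ofList ys) (N := P)
      (W := M ⧸ (Ideal.ofList ys • ⊤ : Submodule R M)) (j := 0 + 1) (by omega)
    obtain ⟨c, rfl⟩ := (ModuleExt.exact_coδ_comap K.injective_subtype hK hp 0 e).1
      (Subsingleton.elim _ _)
    -- The class is the boundary of a map `K → M/ysM`. Over `R`, vanishing of `Ext^{|ys|+1}(X, M)`
    -- makes restriction from `P` to `K` onto in degree `|ys|`, so this map extends to `P` and its
    -- boundary is zero.
    obtain ⟨g, hg⟩ := exists_extension_of_comap_surjective hM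
      (N := P) (N' := K) (fun z hz => Module.mem_annihilator.2 fun x =>
        smul_eq_zero_of_mem_ofList (Ideal.subset_span hz) x)
      (fun z hz => Module.mem_annihilator.2 fun x =>
        smul_eq_zero_of_mem_ofList (Ideal.subset_span hz) x) (K.subtype.restrictScalars R)
      (fun a => (ModuleExt.exact_comap_coδ (R := R) (f := K.subtype.restrictScalars R)
        (g := p.restrictScalars R) K.injective_subtype hK hp ys.length a).1
          (Subsingleton.elim _ _))
      ((ModuleExt.homEquiv c).restrictScalars R)
    refine (ModuleExt.exact_comap_coδ K.injective_subtype hK hp 0 c).2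
      ⟨ModuleExt.homEquiv.symm (g.extendScalarsOfSurjective Ideal.Quotient.mk_surjective), ?_⟩
    apply ModuleExt.homEquiv.injective
    rw [ModuleExt.homEquiv_comap, LinearEquiv.apply_symm_apply]
    exact LinearMap.ext fun x => LinearMap.congr_fun hg x
  | succ i ih =>
    let F := X →₀ R
    let P := F ⧸ (Ideal.ofList ys • ⊤ : Submodule R F)
    have hP : Module.Projective (R ⧸ Ideal.ofList ys) P := projective_quotient_ofList
    let p : P →ₗ[R ⧸ Ideal.ofList ys] X := liftQuotientOfList (Finsupp.linearCombination R id)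
    have hp : Function.Surjective p := fun x =>
      ⟨Submodule.Quotient.mk (Finsupp.single x 1), by
        rw [liftQuotientOfList_mk, Finsupp.linearCombination_single, one_smul, id]⟩
    let K := LinearMap.ker p
    have hK := LinearMap.exact_subtype_ker_map p
    have h₁ : Subsingleton (ModuleExt R P M (ys.length + i + 1)) :=
      subsingleton_ext_quotient_left (isWeaklyRegular_of_free hys) (i := 0)
        (fun j hj => subsingleton_ext_of_projective hj) (by omega)
    have h₂ := ih K (subsingleton_of_exact (map_zero _) (ModuleExt.exact_comap_coδ (R := R)
      (f := K.subtype.restrictScalars R) (g := p.restrictScalars R) K.injective_subtype hK hp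
        (ys.length + i + 1)))
    have h₃ := subsingleton_ext_of_projective (R := R ⧸ Ideal.ofList ys) (N := P)
      (W := M ⧸ (Ideal.ofList ys • ⊤ : Submodule R M)) (j := i + 1 + 1) (by omega)
    exact subsingleton_of_exact (map_zero _)
      (ModuleExt.exact_coδ_comap K.injective_subtype hK hp (i + 1))

/-- The bound `n` is not lowered by the length of `ys`; only finiteness matters for canonical
modules. -/
theorem hasInjectiveDimensionLE_quotient_ofList (hys : IsWeaklyRegular R ys)
    (hM : IsWeaklyRegular M ys) {n : ℕ} (hn : HasInjectiveDimensionLE (ModuleCat.of R M) n) :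
    HasInjectiveDimensionLE (ModuleCat.of (R ⧸ Ideal.ofList ys)
      (M ⧸ (Ideal.ofList ys • ⊤ : Submodule R M))) n := by
  refine hasInjectiveDimensionLT_of_enoughProjectives _ _ fun Y => ?_
  let : Module R Y := Module.compHom Y (algebraMap R (R ⧸ Ideal.ofList ys))
  have : IsScalarTower R (R ⧸ Ideal.ofList ys) Y := .of_algebraMap_smul fun _ _ => rfl
  exact subsingleton_ext_quotient_ofList hys hM n Y
    (HasInjectiveDimensionLT.subsingleton (ModuleCat.of R M) (n + 1) _ (by omega) _)

/-- `(M ⧸ ys M) ⧸ ws (M ⧸ ys M)`, formed over `R ⧸ (ys)`, is `M ⧸ (ys, ws) M`. -/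
theorem nonempty_quotient_append_equiv (ws : List R) :
    Nonempty ((M ⧸ (Ideal.ofList (ys ++ ws) • ⊤ : Submodule R M)) ≃ₗ[R]
      (M ⧸ (Ideal.ofList ys • ⊤ : Submodule R M)) ⧸
        (Ideal.ofList (ws.map (algebraMap R (R ⧸ Ideal.ofList ys))) • ⊤ :
          Submodule (R ⧸ Ideal.ofList ys) (M ⧸ (Ideal.ofList ys • ⊤ : Submodule R M)))) := by
  let q := (Ideal.ofList (ws.map (algebraMap R (R ⧸ Ideal.ofList ys))) • ⊤ :
    Submodule (R ⧸ Ideal.ofList ys) (M ⧸ (Ideal.ofList ys • ⊤ : Submodule R M))).mkQ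
  let φ := q.restrictScalars R ∘ₗ (Ideal.ofList ys • ⊤ : Submodule R M).mkQ
  have hφ : Function.Surjective φ :=
    (Submodule.mkQ_surjective _).comp (Submodule.mkQ_surjective _)
  have hker : LinearMap.ker φ = Ideal.ofList (ys ++ ws) • ⊤ := by
    have hq : LinearMap.ker (q.restrictScalars R) = Ideal.ofList ws • ⊤ := by
      rw [LinearMap.ker_restrictScalars, Submodule.ker_mkQ, ← Ideal.map_ofList,
        Ideal.smul_restrictScalars, Submodule.restrictScalars_top]
    rw [LinearMap.ker_comp, hq, Ideal.ofList_append, Submodule.sup_smul,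
      ← Submodule.range_mkQ, LinearMap.range_eq_map, ← Submodule.map_smul'',
      Submodule.comap_map_eq, Submodule.ker_mkQ, sup_comm]
  exact ⟨(Submodule.quotEquivOfEq _ _ hker.symm).trans (φ.quotKerEquivOfSurjective hφ)⟩

end BaseChange

/-! ### Canonical modules modulo a regular sequence. -/

section Canonical
open IsLocalRing

variable {R : Type u} [CommRing R] [IsLocalRing R]
variable {M : Type u} [AddCommGroup M] [Module R M] {ys : List R}

theorem isRegular_map_pow (h : IsRegular R ys) {k : ℕ} (hk : k ≠ 0) :
    IsRegular R (ys.map (· ^ k)) := by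
  refine (IsLocalRing.isRegular_iff_isWeaklyRegular_of_subset_maximalIdeal fun y hy => ?_).2
    (isWeaklyRegular_map_pow h.toIsWeaklyRegular k)
  obtain ⟨x, hx, rfl⟩ := List.mem_map.1 hy
  exact Ideal.pow_mem_of_mem _ (mem_maximalIdeal_of_isRegular h x hx) k (Nat.pos_of_ne_zero hk)

theorem isLocalRing_quotient_ofList (h : IsRegular R ys) : IsLocalRing (R ⧸ Ideal.ofList ys) := by
  have : Nontrivial (R ⧸ Ideal.ofList ys) := by
    refine Ideal.Quotient.nontrivial_iff.2 fun htop => h.top_ne_smul ?_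
    rw [htop, Submodule.top_smul]
  exact IsLocalRing.of_surjective' (Ideal.Quotient.mk _) Ideal.Quotient.mk_surjective

theorem mem_maximalIdeal_map_algebraMap {ws : List R} (hwm : ∀ w ∈ ws, w ∈ maximalIdeal R)
    [IsLocalRing (R ⧸ Ideal.ofList ys)] :
    ∀ w ∈ ws.map (algebraMap R (R ⧸ Ideal.ofList ys)),
      w ∈ maximalIdeal (R ⧸ Ideal.ofList ys) := by
  have hloc : IsLocalHom (algebraMap R (R ⧸ Ideal.ofList ys)) :=
    Function.Surjective.isLocalHom _ Ideal.Quotient.mk_surjective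
  intro w hw
  obtain ⟨w, hw', rfl⟩ := List.mem_map.1 hw
  rw [mem_maximalIdeal, mem_nonunits_iff, isUnit_map_iff]
  exact hwm w hw'

variable [IsNoetherianRing R]

theorem IsMaximalCohenMacaulay.exists_isRegular_append (hM : IsMaximalCohenMacaulay R M)
    (h : IsRegular R ys) [IsLocalRing (R ⧸ Ideal.ofList ys)] :
    ∃ ws : List R, (∀ w ∈ ws, w ∈ maximalIdeal R) ∧
      IsRegular (M ⧸ (Ideal.ofList ys • ⊤ : Submodule R M)) ws ∧ IsRegular M (ys ++ ws) ∧
      ((ys ++ ws).length : WithBot ℕ∞) = ringKrullDim R ∧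
      (ws.length : WithBot ℕ∞) = ringKrullDim (R ⧸ Ideal.ofList ys) := by
  have hy := hM.isRegular h
  obtain ⟨hfin, zs, hzm, hz, hdim⟩ := hM
  obtain ⟨ws, hwm, hws, hyws, hlen⟩ := _root_.exists_isRegular_append
    (mem_maximalIdeal_of_isRegular h) hy.toIsWeaklyRegular hzm hz (length_le_of_isRegular h hdim)
  rw [← hlen] at hdim
  refine ⟨ws, hwm, hws, hyws, hdim, ?_⟩
  have hd := ringKrullDim_add_length_eq_ringKrullDim_of_isRegular _ h
  rw [← hdim] at hd
  cases hx : ringKrullDim (R ⧸ Ideal.ofList ys) with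
  | bot => exact absurd hx ringKrullDim_ne_bot
  | coe e =>
    rw [hx, List.length_append] at hd
    norm_cast at hd ⊢
    refine (ENat.add_left_injective_of_ne_top (ENat.natCast_ne_top ys.length) ?_).symm
    refine hd.trans ?_
    push_cast
    exact add_comm _ _

theorem IsMaximalCohenMacaulay.quotient_ofList (hM : IsMaximalCohenMacaulay R M)
    (h : IsRegular R ys) [IsLocalRing (R ⧸ Ideal.ofList ys)] :
    IsMaximalCohenMacaulay (R ⧸ Ideal.ofList ys)
      (M ⧸ (Ideal.ofList ys • ⊤ : Submodule R M)) := by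
  obtain ⟨ws, hwm, hws, -, -, hdim⟩ := hM.exists_isRegular_append h
  have := hM.finite
  have hfin : Module.Finite (R ⧸ Ideal.ofList ys) (M ⧸ (Ideal.ofList ys • ⊤ : Submodule R M)) :=
    Module.Finite.of_restrictScalars_finite R _ _
  have := hws.nontrivial
  have hwm' := mem_maximalIdeal_map_algebraMap (ys := ys) hwm
  refine ⟨hfin, ws.map (algebraMap R (R ⧸ Ideal.ofList ys)), hwm', ?_, by simpa using hdim⟩
  exact (IsLocalRing.isRegular_iff_isWeaklyRegular_of_subset_maximalIdeal hwm').2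
    ((isWeaklyRegular_map_algebraMap_iff _ _ ws).2 hws.toIsWeaklyRegular)

theorem IsMaximalCohenMacaulay.congr {R M N : Type u} [CommRing R] [IsLocalRing R] [AddCommGroup M]
    [AddCommGroup N] [Module R M] [Module R N] (hM : IsMaximalCohenMacaulay R M) (e : M ≃ₗ[R] N) :
    IsMaximalCohenMacaulay R N := by
  obtain ⟨hfin, zs, hzm, hz, hdim⟩ := hM
  exact ⟨Module.Finite.equiv e, zs, hzm, (e.isRegular_congr zs).1 hz, hdim⟩

theorem IsCohenMacaulayLocal.quotient_ofList {R : Type u} [CommRing R] [IsLocalRing R]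
    (hR : IsCohenMacaulayLocal R) {ys : List R} (h : IsRegular R ys)
    [IsLocalRing (R ⧸ Ideal.ofList ys)] : IsCohenMacaulayLocal (R ⧸ Ideal.ofList ys) := by
  have := hR.noetherian
  refine ⟨inferInstance, (hR.depth_eq_dim.quotient_ofList h).congr ?_⟩
  exact LinearEquiv.extendScalarsOfSurjective Ideal.Quotient.mk_surjective
    (Submodule.quotEquivOfEq _ (Ideal.ofList ys) (by simp))

theorem IsCanonicalModule.quotient_ofList (hM : IsCanonicalModule R M) (h : IsRegular R ys)
    [IsLocalRing (R ⧸ Ideal.ofList ys)] :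
    IsCanonicalModule (R ⧸ Ideal.ofList ys) (M ⧸ (Ideal.ofList ys • ⊤ : Submodule R M)) := by
  have hy := (hM.maximalCohenMacaulay.isRegular h).toIsWeaklyRegular
  refine ⟨hM.maximalCohenMacaulay.quotient_ofList h, ?_, fun d hd => ?_⟩
  · obtain ⟨n, hn⟩ := hM.finite_injectiveDimension
    exact ⟨n, hasInjectiveDimensionLE_quotient_ofList h.toIsWeaklyRegular hy hn⟩
  · obtain ⟨ws, hwm, hws, hyws, hdim, hdim'⟩ := hM.maximalCohenMacaulay.exists_isRegular_append h
    obtain rfl : (ws.map (algebraMap R (R ⧸ Ideal.ofList ys))).length = d := by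
      rw [List.length_map]
      exact_mod_cast hdim'.trans hd
    -- Type one over either ring says that the same module `M/(ys, ws)M` has simple socle.
    refine (nonempty_ext_residueField_equiv_iff
      ((isWeaklyRegular_map_algebraMap_iff _ _ ws).2 hws.toIsWeaklyRegular)
      (mem_maximalIdeal_map_algebraMap hwm)).2 ?_
    obtain ⟨e⟩ := nonempty_quotient_append_equiv (M := M) (ys := ys) ws
    refine (hasSimpleSocle_iff_of_surjective (R := R) Ideal.Quotient.mk_surjective).1
      (HasSimpleSocle.congr e ?_)
    refine (nonempty_ext_residueField_equiv_iff hyws.toIsWeaklyRegular fun a ha => ?_).1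
      (hM.type_one _ hdim.symm)
    rcases List.mem_append.1 ha with ha | ha
    exacts [mem_maximalIdeal_of_isRegular h a ha, hwm a ha]

end Canonical

/-! ### Trace ideals and colength under quotients. -/

section Trace

variable {R : Type u} [CommRing R] {M : Type u} [AddCommGroup M] [Module R M]

theorem traceIdeal_le_comap_quotient (ys : List R) :
    traceIdeal R M ≤ (traceIdeal (R ⧸ Ideal.ofList ys)
      (M ⧸ (Ideal.ofList ys • ⊤ : Submodule R M))).comap (Ideal.Quotient.mk _) := by
  refine iSup_le fun f => ?_
  rintro _ ⟨m, rfl⟩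
  exact Ideal.mem_comap.2 (Submodule.mem_iSup_of_mem
    (liftQuotientOfList ((Ideal.ofList ys).mkQ ∘ₗ f)) ⟨Submodule.Quotient.mk m, rfl⟩)

theorem powersIdeal_succ_le (x : List R) (u : ℕ) : powersIdeal x (u + 1) ≤ powersIdeal x u := by
  refine Ideal.span_le.2 fun a ha => ?_
  obtain ⟨b, hb, rfl⟩ := List.mem_map.1 ha
  rw [SetLike.mem_coe, pow_succ]
  exact Ideal.mul_mem_right _ _ (Ideal.subset_span (List.mem_map.2 ⟨b, hb, rfl⟩))

/-- A functional on the quotient module is an `R`-linear map from `M` to `R/(x^{u+1})`; a lift `f`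
modulo `(x^u)` puts its values in the trace up to `(x^u)`. -/
theorem comap_traceIdeal_quotient_le {x : List R} (hx : IsWeaklyRegular R x) {u : ℕ} (hu : 1 ≤ u)
    (hann : ∀ i, 1 ≤ i → i ≤ x.length → ∀ a ∈ x, ∀ e : ModuleExt R M R i, a • e = 0) :
    (traceIdeal (R ⧸ powersIdeal x (u + 1))
      (M ⧸ (powersIdeal x (u + 1) • ⊤ : Submodule R M))).comap (Ideal.Quotient.mk _) ≤
      traceIdeal R M ⊔ powersIdeal x u := by
  let J := traceIdeal R M ⊔ powersIdeal x u
  have hle : traceIdeal (R ⧸ powersIdeal x (u + 1))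
      (M ⧸ (powersIdeal x (u + 1) • ⊤ : Submodule R M)) ≤
      J.map (Ideal.Quotient.mk (powersIdeal x (u + 1))) := by
    refine iSup_le fun g => ?_
    rintro _ ⟨m, rfl⟩
    obtain ⟨m, rfl⟩ := Submodule.Quotient.mk_surjective _ m
    let e := Submodule.quotEquivOfEq (powersIdeal x (u + 1))
      (Ideal.ofList (x.map (· ^ (u + 1))) • ⊤) (by simp [powersIdeal])
    obtain ⟨f, hf⟩ := exists_lift_of_smul_ext_eq_zero hu hx hann
      (e.toLinearMap ∘ₗ g.restrictScalars R ∘ₗ Submodule.mkQ _)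
    obtain ⟨r, hr⟩ := Ideal.Quotient.mk_surjective (g (Submodule.Quotient.mk m))
    have hfr : f m - r ∈ powersIdeal x u := by
      have := hf m r (congrArg e hr.symm)
      simpa [powersIdeal] using this
    rw [← hr]
    refine Ideal.mem_map_of_mem _ ?_
    rw [← sub_sub_cancel (f m) r]
    exact sub_mem (Submodule.mem_sup_left (Submodule.mem_iSup_of_mem f ⟨m, rfl⟩))
      (Submodule.mem_sup_right hfr)
  refine (Ideal.comap_mono hle).trans ?_
  rw [Ideal.comap_map_of_surjective' _ Ideal.Quotient.mk_surjective, Ideal.mk_ker]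
  exact sup_le le_rfl ((powersIdeal_succ_le x u).trans le_sup_right)

theorem length_quotient_comap_mk (I : Ideal R) (T : Ideal (R ⧸ I)) :
    Module.length R (R ⧸ T.comap (Ideal.Quotient.mk I)) = Module.length (R ⧸ I) ((R ⧸ I) ⧸ T) := by
  let φ : R →ₗ[R] (R ⧸ I) ⧸ T := T.mkQ.restrictScalars R ∘ₗ I.mkQ
  have hφ : Function.Surjective φ := T.mkQ_surjective.comp I.mkQ_surjective
  have hker : LinearMap.ker φ = T.comap (Ideal.Quotient.mk I) := by
    ext r
    exact Submodule.Quotient.mk_eq_zero T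
  rw [← hker, (φ.quotKerEquivOfSurjective hφ).length_eq]
  exact Module.length_eq_of_surjective Ideal.Quotient.mk_surjective

end Trace

theorem theorem3p6 {R : Type u} [CommRing R] [IsLocalRing R] (hR : IsCohenMacaulayLocal R)
    {ω : Type u} [AddCommGroup ω] [Module R ω] (hω : IsCanonicalModule R ω)
    (x : List R) (hx : RingTheory.Sequence.IsRegular R x) (u : ℕ) (hu : 1 ≤ u)
    (hann : ∀ i : ℕ, 1 ≤ i → i ≤ x.length → ∀ a ∈ x,
      a ∈ Module.annihilator R
        (CategoryTheory.Abelian.Ext (ModuleCat.of R ω) (ModuleCat.of R R) i)) :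
    ∃ _ : IsLocalRing (R ⧸ powersIdeal x (u + 1)),
      IsCohenMacaulayLocal (R ⧸ powersIdeal x (u + 1)) ∧
      (∃ (ω' : Type u) (_ : AddCommGroup ω') (_ : Module (R ⧸ powersIdeal x (u + 1)) ω'),
        IsCanonicalModule (R ⧸ powersIdeal x (u + 1)) ω') ∧
      ∀ (ω' : Type u) [AddCommGroup ω'] [Module (R ⧸ powersIdeal x (u + 1)) ω'],
        IsCanonicalModule (R ⧸ powersIdeal x (u + 1)) ω' →
          traceIdeal R ω ⊔ powersIdeal x u =
            (traceIdeal (R ⧸ powersIdeal x (u + 1)) ω').comap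
              (Ideal.Quotient.mk (powersIdeal x (u + 1))) ⊔ powersIdeal x u ∧
          (powersIdeal x u ≤ traceIdeal R ω →
            canonicalResidue R ω = canonicalResidue (R ⧸ powersIdeal x (u + 1)) ω') := by
  have := hR.noetherian
  have hy : IsRegular R (x.map (· ^ (u + 1))) := isRegular_map_pow hx (Nat.succ_ne_zero u)
  have := isLocalRing_quotient_ofList hy
  have hloc : IsLocalRing (R ⧸ powersIdeal x (u + 1)) := this
  have hS : IsCohenMacaulayLocal (R ⧸ powersIdeal x (u + 1)) := hR.quotient_ofList hy
  have hcan : IsCanonicalModule (R ⧸ powersIdeal x (u + 1))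
      (ω ⧸ (powersIdeal x (u + 1) • ⊤ : Submodule R ω)) := hω.quotient_ofList hy
  refine ⟨hloc, hS, ⟨_, _, _, hcan⟩, fun ω' _ _ hω' => ?_⟩
  have := hS.noetherian
  -- An arbitrary canonical module may be replaced by `ω/(x^{u+1})ω`, as only its trace matters.
  have htr := le_antisymm (hcan.traceIdeal_le hS.depth_eq_dim hω')
    (hω'.traceIdeal_le hS.depth_eq_dim hcan)
  have hle : traceIdeal R ω ≤ (traceIdeal (R ⧸ powersIdeal x (u + 1)) ω').comap
      (Ideal.Quotient.mk (powersIdeal x (u + 1))) := by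
    rw [htr]
    exact traceIdeal_le_comap_quotient _
  have hge : (traceIdeal (R ⧸ powersIdeal x (u + 1)) ω').comap
      (Ideal.Quotient.mk (powersIdeal x (u + 1))) ≤ traceIdeal R ω ⊔ powersIdeal x u := by
    rw [htr]
    exact comap_traceIdeal_quotient_le hx.toIsWeaklyRegular hu fun i hi hi' a ha =>
      Module.mem_annihilator.1 (hann i hi hi' a ha)
  refine ⟨le_antisymm (sup_le_sup_right hle _) (sup_le hge le_sup_right), fun hpow => ?_⟩
  rw [sup_eq_left.2 hpow] at hge
  unfold canonicalResidue
  rw [le_antisymm hle hge]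
  exact length_quotient_comap_mk _ _
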